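/- **Setting.** Let $t\in\mathbb C^\times$ not be a root of unity, $\epsilon,\mu\in\{1,-1\}$, and set $q^{1/2}=\mathrm i\mu t$, $q=(q^{1/2})^2=-t^2$, $p=-\mathrm i\epsilon q^{-1}$, $(x;q)_m=\prod_{j=1}^m(1-xq^{j-1})$. Let $V=\bigoplus_{\alpha\in\{0,1\}^n}\mathbb C|\alpha\rangle$, $|\alpha|=\alpha_1+\dots+\alpha_n$, with $|\beta\rangle:=0$ for $\beta\in\mathbb Z^n\setminus\{0,1\}^n$, and let $\sigma^x|\alpha\rangle=|\mathbf 1-\alpha\rangle$ be the spin reversal. Let $\mathbf e_1,\dots,\mathbf e_n$ be the unit vectors. For $v\in\mathbb Z^n$ and $x\in\mathbb C^\times$ let $e|\alpha\rangle=x|\alpha+v\rangle$, $f|\alpha\rangle=x^{-1}|\alpha-v\rangle$, $k|\alpha\rangle=p^{\sum_i v_i(2\alpha_i-1)}|\alpha\rangle$, and put $b[v,x;c,d]=f+c\,k^{-1}e+d\,k^{-1}\in\mathrm{End}\,V$. Write $d_0=\frac1{q+q^{-1}}$. *Generators, type $A^{(1)}_{n-1}$ ($n\ge3$).* With $\mathbf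 e_0=\mathbf e_n$: $b_0=b[-\mathbf e_0+\mathbf e_1,z;p^2,d_0]$, and $b_i=b[-\mathbf e_i+\mathbf e_{i+1},1;p^2,d_0]$ for $0<i<n$. Put $H_{\rm tr}(z)=b_0+b_1+\dots+b_{n-1}$. *Generators, types $D^{(2)}_{n+1}$ ($n\ge 2$), $B^{(1)}_n$, $\tilde B^{(1)}_n$, $D^{(1)}_n$ ($n\ge3$)*, labelled by $(k,k')=(1,1),(2,1),(1,2),(2,2)$ respectively. Let $d^1=\epsilon\frac{q^{1/2}+q^{-1/2}}{q+q^{-1}}$, $d^2=d_0$, $v^1_0=\mathbf e_1$, $v^2_0=\mathbf e_1+\mathbf e_2$, $v^1_n=-\mathbf e_n$, $v^2_n=-\mathbf e_{n-1}-\mathbf e_n$. Then $b_0=b[v_0^{k},z^{k};p^{k},d^{k}]$, $b_i=b[-\mathbf e_i+\mathbf e_{i+1},1;p^2,d_0]$ for $0<i<n$, and $b_n=b[v_n^{k'},1;p^{k'},d^{k'}]$. Put $H_{k,k'}(z)=\sum_{i=0}^n\kappa_ib_i$, that is, $$H_{1,1}(z)=-\tfrac{\mu(t+t^{-1})}2b_0+b_1+\dots+b_{n-1}-\tfrac{\mu(t+t^{-1})}2b_n,$$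 $$H_{2,1}(z)=b_0+b_1+2(b_2+\dots+b_{n-1})-\mu(t+t^{-1})b_n,$$ $$H_{1,2}(z)=-\mu(t+t^{-1})b_0+2(b_1+\dots+b_{n-2})+b_{n-1}+b_n,$$ $$H_{2,2}(z)=\sum_{i=0}^n\kappa_ib_i,\qquad \kappa_i=1\text{ for }i\in\{0,1,n-1,n\},\quad \kappa_i=2\text{ otherwise}.$$ *$K$ matrices.* On the $q$-boson Fock space with basis $|m\rangle$ ($m\ge0$) and pairing $\langle m|m'\rangle=(q^2;q^2)_m\delta_{m,m'}$ let $\mathbf a^+|m\rangle=|m+1\rangle$, $\mathbf a^-|m\rangle=(1-q^{2m})|m-1\rangle$, $\mathbf k|m\rangle=q^m|m\rangle$, $\mathbf h|m\rangle=m|m\rangle$, and let $K^0_0=\mathbf a^+$, $K^0_1=-q\mathbf k$, $K^1_0=\mathbf k$, $K^1_1=\mathbf a^-$. Put $|\eta_k\rangle=\sum_{m\ge0}\frac{|km\rangle}{(q^{k^2};q^{k^2})_m}$, $\langle\eta_k|=\sum_{m\ge0}\frac{\langle km|}{(q^{k^2};q^{k^2})_m}$. Define $K_{\rm tr}(z)$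 and $K_{k,k'}(z)$ on $V$ by $K(z)|\alpha\rangle=\sum_\beta K(z)_\alpha^\beta|\beta\rangle$ with $$K_{\rm tr}(z)_\alpha^\beta=(-1)^{l}q^{\min(0,2l-n)}(1-q^{|n-2l|}z)\,\mathrm{Tr}(z^{\mathbf h}K^{\beta_1}_{\alpha_1}\cdots K^{\beta_n}_{\alpha_n}),\qquad l=|\alpha|,$$ $$K_{k,k'}(z)_\alpha^\beta=\langle\eta_k|z^{\mathbf h}|\eta_{k'}\rangle^{-s}\,\langle\eta_k|z^{\mathbf h}K^{\beta_1}_{\alpha_1}\cdots K^{\beta_n}_{\alpha_n}|\eta_{k'}\rangle,$$ where $s=(-1)^n$ if $k=k'=2$ and $s=1$ otherwise. These entries are formal power series in $z$. Let $S=\mathrm{diag}\big((\mathrm iq^{1/2})^{|\alpha|}\big)_\alpha$ and $K^\vee_{\rm tr}(z)=\sigma^xK_{\rm tr}(z)$, $K^\vee_{k,k'}(z)=\sigma^xSK_{k,k'}(z)S^{-1}$. **Theorem.** All the coefficients $\kappa_i$ above are nonzero, and for $H=H_{\rm tr},H_{1,1},H_{2,1},H_{1,2},H_{2,2}$ and every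 $z\in\mathbb C^\times$ $$\sigma^xH(z)\sigma^x=H(z^{-1}).$$ The entries of $K_{\rm tr}(z)$ and $K_{k,k'}(z)$ are the expansions at $z=0$ of rational functions of $z$, and for every $z\in\mathbb C^\times$ that is not a pole of one of these entries $$[K^\vee_{\rm tr}(z),H_{\rm tr}(z)]=0,\qquad[K^\vee_{k,k'}(z),H_{k,k'}(z)]=0\quad(k,k'\in\{1,2\}).$$ -/

import Mathlib

namespace OnsagerSpin

noncomputable section

open scoped PowerSeries

/-! ## Parameters -/

/-- The square root `q^{1/2} = i μ t`. -/
def sqrtq (t μ : ℂ) : ℂ := Complex.I * μ * t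

/-- `q = (q^{1/2})^2`. -/
def qPar (t μ : ℂ) : ℂ := sqrtq t μ ^ 2

/-- `p = - i ε q^{-1}`. -/
def pPar (t μ ε : ℂ) : ℂ := -Complex.I * ε * (qPar t μ)⁻¹

/-- The finite product `(x; q)_m = ∏_{j=1}^m (1 - x q^{j-1})`. -/
def qPoch (x q : ℂ) (m : ℕ) : ℂ := ∏ j ∈ Finset.range m, (1 - x * q ^ j)

/-! ## The space `V = (ℂ²)^{⊗ n}` and its operators -/

/-- Labels `α = (α_1, …, α_n) ∈ {0,1}^n` of the basis vectors `|α⟩` of `V`.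
The site `j ∈ {1, …, n}` is the element `j - 1` of `Fin n`. -/
abbrev Conf (n : ℕ) := Fin n → Fin 2

/-- Operators on `V` as matrices: `A |α⟩ = ∑_β A β α |β⟩`. -/
abbrev Op (n : ℕ) := Matrix (Conf n) (Conf n) ℂ

/-- `|α| = α_1 + ⋯ + α_n`. -/
def wt {n : ℕ} (α : Conf n) : ℕ := ∑ i, (α i : ℕ)

/-- The elementary vector `e_j ∈ ℤ^n` for `1 ≤ j ≤ n`. -/
def unitVec (n j : ℕ) : Fin n → ℤ := fun i => if (i : ℕ) + 1 = j then 1 else 0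

/-- The operator `|α⟩ ↦ |α + v⟩`, where `|β⟩ = 0` if `β ∉ {0,1}^n`. -/
def shiftOp {n : ℕ} (v : Fin n → ℤ) : Op n :=
  Matrix.of fun β α => if ∀ i, ((β i : ℕ) : ℤ) = ((α i : ℕ) : ℤ) + v i then 1 else 0

/-- The global spin reversal `σ^x |α⟩ = |1 - α⟩`. -/
def sigmaX (n : ℕ) : Op n :=
  Matrix.of fun β α => if ∀ i, (β i : ℕ) + (α i : ℕ) = 1 then 1 else 0

/-! ## Generators of the quantum affine algebras in the fundamental and spin representations

In all the representations the generators attached to a vertex are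
`e |α⟩ = x |α + v⟩`, `f |α⟩ = x⁻¹ |α - v⟩` and
`k |α⟩ = p^{v_1 (2 α_1 - 1) + ⋯ + v_n (2 α_n - 1)} |α⟩`
for a vector `v ∈ ℤ^n` and a scalar `x`, which is `1` except at the vertex `0`.
For `v = - e_j + e_{j+1}` the exponent is `2 (α_{j+1} - α_j)`; for `v = e_1` it is `2 α_1 - 1`;
for `v = e_1 + e_2` it is `2 (α_1 + α_2 - 1)`; for `v = - e_n` it is `1 - 2 α_n`;
for `v = - e_{n-1} - e_n` it is `2 (1 - α_{n-1} - α_n)`. -/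

def eOp {n : ℕ} (v : Fin n → ℤ) (x : ℂ) : Op n := x • shiftOp v

def fOp {n : ℕ} (v : Fin n → ℤ) (x : ℂ) : Op n := x⁻¹ • shiftOp (-v)

/-- The inverse `k⁻¹`. -/
def kInvOp {n : ℕ} (p : ℂ) (v : Fin n → ℤ) : Op n :=
  Matrix.diagonal fun α => p ^ (-∑ i, v i * (2 * ((α i : ℕ) : ℤ) - 1))

/-- The element `f + c k⁻¹ e + d k⁻¹`. -/
def onsagerOp {n : ℕ} (p c d : ℂ) (v : Fin n → ℤ) (x : ℂ) : Op n :=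
  fOp v x + c • (kInvOp p v * eOp v x) + d • kInvOp p v

/-! ### Type `A^{(1)}_{n-1}` -/

/-- The vector `- e_i + e_{i+1}` for `i ∈ ℤ_n`, `0 ≤ i < n`, with `e_0 = e_n`. -/
def rootA (n i : ℕ) : Fin n → ℤ := -unitVec n (if i = 0 then n else i) + unitVec n (i + 1)

/-- `b_i = f_i + p² k_i⁻¹ e_i + (q + q⁻¹)⁻¹ k_i⁻¹` for `0 ≤ i < n`. -/
def bTr (t μ ε : ℂ) (n i : ℕ) (z : ℂ) : Op n :=
  onsagerOp (pPar t μ ε) (pPar t μ ε ^ 2) (1 / (qPar t μ + (qPar t μ)⁻¹)) (rootA n i)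
    (if i = 0 then z else 1)

/-- `H_tr(z) = b_0 + b_1 + ⋯ + b_{n-1}`. -/
def HTr (t μ ε : ℂ) (n : ℕ) (z : ℂ) : Op n := ∑ i ∈ Finset.range n, bTr t μ ε n i z

/-! ### Types `D^{(2)}_{n+1}`, `B^{(1)}_n`, `B̃^{(1)}_n`, `D^{(1)}_n`

These are `(r, r') = (1,1), (2,1), (1,2), (2,2)`, respectively. -/

def rootBD (r r' n i : ℕ) : Fin n → ℤ :=
  if i = 0 then (if r = 1 then unitVec n 1 else unitVec n 1 + unitVec n 2)
  else if i = n then (if r' = 1 then -unitVec n n else -unitVec n (n - 1) - unitVec n n)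
  else -unitVec n i + unitVec n (i + 1)

/-- `d^1_1 = ε (q^{1/2} + q^{-1/2}) / (q + q⁻¹)` and `d^2_2 = 1 / (q + q⁻¹)`. -/
def dCoeff (t μ ε : ℂ) (r : ℕ) : ℂ :=
  if r = 1 then ε * (sqrtq t μ + (sqrtq t μ)⁻¹) / (qPar t μ + (qPar t μ)⁻¹)
  else 1 / (qPar t μ + (qPar t μ)⁻¹)

/-- The generators `b_0, …, b_n` in the representation `π^{r,r'}_{r,r'}`:
`b_0 = f_0 + p^r k_0⁻¹ e_0 + d^r_r k_0⁻¹`, `b_n = f_n + p^{r'} k_n⁻¹ e_n + d^{r'}_{r'} k_n⁻¹`,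
`b_i = f_i + p² k_i⁻¹ e_i + (q + q⁻¹)⁻¹ k_i⁻¹` for `0 < i < n`;
the spectral parameter enters as `e_0 = z^r (⋯)`, `f_0 = z^{-r} (⋯)`. -/
def bBD (t μ ε : ℂ) (r r' n i : ℕ) (z : ℂ) : Op n :=
  if i = 0 then
    onsagerOp (pPar t μ ε) (pPar t μ ε ^ r) (dCoeff t μ ε r) (rootBD r r' n i) (z ^ r)
  else if i = n then
    onsagerOp (pPar t μ ε) (pPar t μ ε ^ r') (dCoeff t μ ε r') (rootBD r r' n i) 1
  else
    onsagerOp (pPar t μ ε) (pPar t μ ε ^ 2) (1 / (qPar t μ + (qPar t μ)⁻¹)) (rootBD r r' n i) 1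

/-- The coefficients `κ_0, …, κ_n` of the Hamiltonian `H_{r,r'}(z)`. -/
def kappaBD (t μ : ℂ) (r r' n i : ℕ) : ℂ :=
  match r, r' with
  | 1, 1 => if i = 0 ∨ i = n then -(μ * (t + t⁻¹) / 2) else 1
  | 2, 1 => if i = 0 ∨ i = 1 then 1 else if i = n then -(μ * (t + t⁻¹)) else 2
  | 1, 2 => if i = 0 then -(μ * (t + t⁻¹)) else if i = n - 1 ∨ i = n then 1 else 2
  | 2, 2 => if i = 0 ∨ i = 1 ∨ i = n - 1 ∨ i = n then 1 else 2
  | _, _ => 0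

/-- `H_{r,r'}(z) = κ_0 b_0 + κ_1 b_1 + ⋯ + κ_n b_n`. -/
def HBD (t μ ε : ℂ) (r r' n : ℕ) (z : ℂ) : Op n :=
  ∑ i ∈ Finset.range (n + 1), kappaBD t μ r r' n i • bBD t μ ε r r' n i z

/-! ## The `q`-boson Fock space

The sequence `v : ℕ → ℂ` stands for the (possibly infinite) combination `∑_m v m |m⟩`;
this space holds the basis vectors as well as the boundary vectors. -/

abbrev Fock := ℕ → ℂ

/-- `a⁺ |m⟩ = |m+1⟩`. -/
def aPlus : Module.End ℂ Fock where
  toFun v m := if m = 0 then 0 else v (m - 1)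
  map_add' u v := by
    funext m
    by_cases h : m = 0 <;> simp [h]
  map_smul' c v := by
    funext m
    by_cases h : m = 0 <;> simp [h]

/-- `a⁻ |m⟩ = (1 - q^{2m}) |m-1⟩`. -/
def aMinus (q : ℂ) : Module.End ℂ Fock where
  toFun v m := (1 - q ^ (2 * (m + 1))) * v (m + 1)
  map_add' u v := by
    funext m
    simp [mul_add]
  map_smul' c v := by
    funext m
    simp [mul_left_comm]

/-- `k |m⟩ = q^m |m⟩`. -/
def kBoson (q : ℂ) : Module.End ℂ Fock where
  toFun v m := q ^ m * v m
  map_add' u v := by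
    funext m
    simp [mul_add]
  map_smul' c v := by
    funext m
    simp [mul_left_comm]

/-- `K^β_α`, with `K^0_0 = a⁺`, `K^0_1 = - q k`, `K^1_0 = k`, `K^1_1 = a⁻`. -/
def locK (q : ℂ) (β α : Fin 2) : Module.End ℂ Fock :=
  !![aPlus, -(q • kBoson q); kBoson q, aMinus q] β α

/-- `K^{β_1}_{α_1} ⋯ K^{β_n}_{α_n}`. -/
def prodK (q : ℂ) {n : ℕ} (β α : Conf n) : Module.End ℂ Fock :=
  (List.ofFn fun i => locK q (β i) (α i)).prod

/-! ## The `K` matrices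

The matrix elements are rational functions of `z`; here are their expansions at `z = 0`. -/

/-- `Tr(z^h X) = ∑_m z^m X_{m,m}`. -/
def traceZ (X : Module.End ℂ Fock) : ℂ⟦X⟧ := PowerSeries.mk fun m => X (Pi.single m 1) m

/-- The element `K_tr(z)_α^β = κ_{tr,l}(z) Tr(z^h K^{β_1}_{α_1} ⋯ K^{β_n}_{α_n})` with `l = |α|` and
`κ_{tr,l}(z) = (-1)^l q^{min(0, 2l-n)} (1 - q^{|n-2l|} z)`. -/
def KTrSeries (q : ℂ) {n : ℕ} (β α : Conf n) : ℂ⟦X⟧ :=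
  PowerSeries.C ((-1) ^ wt α * q ^ min (0 : ℤ) (2 * (wt α : ℤ) - n)) *
    (1 - PowerSeries.C (q ^ |(n : ℤ) - 2 * (wt α : ℤ)|) * PowerSeries.X) * traceZ (prodK q β α)

/-- The boundary vector `|η_k⟩ = ∑_m |k m⟩ / (q^{k²}; q^{k²})_m`. -/
def eta (q : ℂ) (k : ℕ) : Fock :=
  fun m => if k ∣ m then (qPoch (q ^ k ^ 2) (q ^ k ^ 2) (m / k))⁻¹ else 0

/-- `⟨η_k| z^h X |η_{k'}⟩`, where `⟨η_k| = ∑_m ⟨k m| / (q^{k²}; q^{k²})_m` and the pairing is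
`⟨m|m'⟩ = (q²; q²)_m δ_{m,m'}`. -/
def bdry (q : ℂ) (k k' : ℕ) (X : Module.End ℂ Fock) : ℂ⟦X⟧ :=
  PowerSeries.mk fun m => eta q k m * qPoch (q ^ 2) (q ^ 2) m * X (eta q k') m

/-- The element `K_{k,k'}(z)_α^β = κ ⟨η_k| z^h K^{β_1}_{α_1} ⋯ K^{β_n}_{α_n} |η_{k'}⟩`, where
`κ = ⟨η_k| z^h |η_{k'}⟩⁻¹`, except that `κ = ⟨η_2| z^h |η_2⟩` for `k = k' = 2` and `n` odd. -/
def KSeries (q : ℂ) (k k' : ℕ) {n : ℕ} (β α : Conf n) : ℂ⟦X⟧ :=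
  (if k = 2 ∧ k' = 2 ∧ Odd n then bdry q k k' 1 else (bdry q k k' 1)⁻¹) *
    bdry q k k' (prodK q β α)

/-- The rational function `f` (in lowest terms) has the power series expansion `s` at `0`. -/
def HasExpansion (f : RatFunc ℂ) (s : ℂ⟦X⟧) : Prop :=
  (f.num : ℂ⟦X⟧) = s * (f.denom : ℂ⟦X⟧)

/-- `z` is not a pole of any entry of `K`. -/
def IsRegularAt {n : ℕ} (K : Matrix (Conf n) (Conf n) (RatFunc ℂ)) (z : ℂ) : Prop :=
  ∀ β α, (K β α).denom.eval z ≠ 0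

/-- The value of `K` at `z`. -/
def valueAt {n : ℕ} (K : Matrix (Conf n) (Conf n) (RatFunc ℂ)) (z : ℂ) : Op n :=
  K.map fun f => f.eval (RingHom.id ℂ) z

/-- The gauge matrix `S = diag((i q^{1/2})^{|α|})`. -/
def gaugeS (t μ : ℂ) (n : ℕ) : Op n :=
  Matrix.diagonal fun α => (Complex.I * sqrtq t μ) ^ wt α

/-- `K^∨_tr(z) = σ^x K_tr(z)`. -/
def KveeTr {n : ℕ} (K : Matrix (Conf n) (Conf n) (RatFunc ℂ)) (z : ℂ) : Op n :=
  sigmaX n * valueAt K z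

/-- `K^∨_{k,k'}(z) = σ^x S K_{k,k'}(z) S⁻¹`. -/
def KveeBD (t μ : ℂ) {n : ℕ} (K : Matrix (Conf n) (Conf n) (RatFunc ℂ)) (z : ℂ) : Op n :=
  sigmaX n * (gaugeS t μ n * valueAt K z * (gaugeS t μ n)⁻¹)

end

end OnsagerSpin

/-! The commutator reduces to one intertwining relation per generator. Let W be K in the trace case
and S K S⁻¹ otherwise. If W b_i(z) = b_i(z⁻¹) W for every i, then W H(z) = H(z⁻¹) W, and with σˣ
H(z) σˣ = H(z⁻¹) this makes σˣ W commute with H(z) (`lie_sigmaX_mul_eq_zero`).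

Intertwining. K is a matrix product and b_i touches only two neighbouring sites, so the relation is
local (`prodK_upd`, `bondOp_intertwine`). In the bulk it is an identity of the q-boson algebra,
valid for any functional closing the product (`locK_bulk`). At an open end it uses the action of a⁺,
a⁻ on the boundary vector (`locK_right_one`, `locK_right_two`, `locK_left_one`, `locK_left_two`). On
the bond closing the periodic chain, cyclicity of the trace brings it back to the bulk identity
(`prodMat_trace`). All this is done for formal power series and then evaluated at regular points
(`valueAt_mul_eq`).

Rationality. Up to a shift, a monomial in the q-bosons multiplies the m-th coefficient of F(z) =
⟨η_k|z^h|η_k'⟩ by a polynomial in q^m, which gives combinations of the series F(q^j z). A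
first-order q-difference equation for F makes these rational multiples of F (`RatMul.weighted`). For
k = k' = 2 the equation has step q² only. The parity of n then selects F(z) or F(qz), and F(z) F(qz)
= 1/(1 - z²) explains the inverted normalisation for odd n.

Spin reversal. The difference σˣ b_i(z) σˣ - b_i(z⁻¹) is diagonal and affine in the occupation
numbers. The weights κ_i make the sum of these differences telescope to zero (`sum_kappaBD`). -/

namespace OnsagerSpin

noncomputable section

open scoped PowerSeries

/-! ## Power series with rational ratio -/

/-- `G / F` is a rational function. -/
def RatMul (F G : ℂ⟦X⟧) : Prop :=
  ∃ p d : Polynomial ℂ, d ≠ 0 ∧ G * (d : ℂ⟦X⟧) = p * F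

namespace RatMul

variable {F G G' : ℂ⟦X⟧}

theorem refl (F : ℂ⟦X⟧) : RatMul F F := ⟨1, 1, one_ne_zero, by simp⟩

theorem zero (F : ℂ⟦X⟧) : RatMul F 0 := ⟨0, 1, one_ne_zero, by simp⟩

theorem add (h : RatMul F G) (h' : RatMul F G') : RatMul F (G + G') := by
  obtain ⟨p, d, hd, h⟩ := h
  obtain ⟨p', d', hd', h'⟩ := h'
  refine ⟨p * d' + p' * d, d * d', mul_ne_zero hd hd', ?_⟩
  push_cast
  linear_combination (d' : ℂ⟦X⟧) * h + (d : ℂ⟦X⟧) * h'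

theorem poly_mul (h : RatMul F G) (r : Polynomial ℂ) : RatMul F (r * G) := by
  obtain ⟨p, d, hd, h⟩ := h
  refine ⟨r * p, d, hd, ?_⟩
  push_cast
  linear_combination (r : ℂ⟦X⟧) * h

theorem C_mul (h : RatMul F G) (c : ℂ) : RatMul F (PowerSeries.C c * G) := by
  simpa using h.poly_mul (Polynomial.C c)

theorem X_mul (h : RatMul F G) : RatMul F (PowerSeries.X * G) := by
  simpa using h.poly_mul Polynomial.X

theorem trans {E : ℂ⟦X⟧} (h : RatMul E F) (h' : RatMul F G) : RatMul E G := by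
  obtain ⟨p, d, hd, h⟩ := h
  obtain ⟨p', d', hd', h'⟩ := h'
  refine ⟨p * p', d * d', mul_ne_zero hd hd', ?_⟩
  push_cast
  linear_combination (d : ℂ⟦X⟧) * h' + (p' : ℂ⟦X⟧) * h

theorem mul_left (h : RatMul F G) (E : ℂ⟦X⟧) : RatMul (E * F) (E * G) := by
  obtain ⟨p, d, hd, h⟩ := h
  exact ⟨p, d, hd, by linear_combination E * h⟩

theorem of_mul_eq {p d : Polynomial ℂ} (hd : d ≠ 0) (h : G * (d : ℂ⟦X⟧) = p * F) : RatMul F G :=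
  ⟨p, d, hd, h⟩

end RatMul

theorem rescale_coe (a : ℂ) (p : Polynomial ℂ) :
    PowerSeries.rescale a (p : ℂ⟦X⟧) = (p.comp (Polynomial.C a * Polynomial.X) : Polynomial ℂ) := by
  ext n
  rw [PowerSeries.coeff_rescale, Polynomial.coeff_coe, Polynomial.coeff_coe,
    Polynomial.comp_C_mul_X_coeff, mul_comm]

theorem comp_C_mul_X_ne_zero {a : ℂ} (ha : a ≠ 0) {p : Polynomial ℂ} (hp : p ≠ 0) :
    p.comp (Polynomial.C a * Polynomial.X) ≠ 0 := by
  intro h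
  apply hp
  ext n
  have := congrArg (fun r => Polynomial.coeff r n) h
  simpa [ha] using this

theorem RatMul.rescale {F G : ℂ⟦X⟧} (h : RatMul F G) {a : ℂ} (ha : a ≠ 0) :
    RatMul (PowerSeries.rescale a F) (PowerSeries.rescale a G) := by
  obtain ⟨p, d, hd, h⟩ := h
  refine ⟨p.comp (Polynomial.C a * Polynomial.X), _, comp_C_mul_X_ne_zero ha hd, ?_⟩
  rw [← rescale_coe, ← rescale_coe, ← map_mul, h, map_mul]

/-- If `F(a z) / F(z)` is rational then so is `(P(a^m) F_m)_m / F` for all polynomials `P`. -/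
theorem RatMul.weighted {F G : ℂ⟦X⟧} {a : ℂ} (ha : a ≠ 0)
    (hF : RatMul F (PowerSeries.rescale a F)) (hG : RatMul F G) (P : Polynomial ℂ) :
    RatMul F (PowerSeries.mk fun m => P.eval (a ^ m) * PowerSeries.coeff m G) := by
  induction P using Polynomial.induction_on' with
  | add p q hp hq =>
    convert hp.add hq using 1
    ext m
    simp [add_mul]
  | monomial j c =>
    have h : ∀ j : ℕ, RatMul F (PowerSeries.mk fun m => (a ^ m) ^ j * PowerSeries.coeff m G) := by
      intro j
      induction j with
      | zero =>
        convert hG using 1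
        ext m
        simp
      | succ j ih =>
        -- The weight a^{mj} is the substitution z ↦ a^j z. One more substitution turns a multiple
        -- of F(z) into a multiple of F(az), hence again of F(z).
        convert hF.trans (ih.rescale ha) using 1
        ext m
        simp [PowerSeries.coeff_rescale]
        ring
    convert (h j).C_mul c using 1
    ext m
    simp
    ring

/-- `s` is the expansion of a rational function. -/
theorem exists_hasExpansion {s : ℂ⟦X⟧} (h : RatMul 1 s) : ∃ f : RatFunc ℂ, HasExpansion f s := by
  obtain ⟨p, d, hd, h⟩ := h
  rw [mul_one] at h
  have hd' : algebraMap (Polynomial ℂ) (RatFunc ℂ) d ≠ 0 := by simpa using hd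
  refine ⟨algebraMap _ _ p / algebraMap _ _ d, ?_⟩
  set f : RatFunc ℂ := algebraMap _ _ p / algebraMap _ _ d with hf
  -- `HasExpansion` refers to lowest terms, while p/d need not be reduced, so the two fractions are
  -- compared by cross-multiplication.
  have h1 : f.num * d = p * f.denom := by
    apply RatFunc.algebraMap_injective ℂ
    have h2 := RatFunc.num_div_denom f
    have h3 : algebraMap (Polynomial ℂ) (RatFunc ℂ) f.denom ≠ 0 := by
      simpa using f.denom_ne_zero
    rw [div_eq_iff h3] at h2
    rw [map_mul, map_mul, h2, hf]
    field_simp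
  have h2 : (f.num : ℂ⟦X⟧) * d = p * f.denom := by exact_mod_cast congrArg Polynomial.toPowerSeries h1
  have hd0 : (d : ℂ⟦X⟧) ≠ 0 := by
    rw [Ne, Polynomial.coe_eq_zero_iff]
    exact hd
  apply mul_right_cancel₀ hd0
  rw [h2, ← h]
  ring

/-! ## Values of power series at regular points -/

/-- The power series `s` is rational, and regular at `z` with value `v`. -/
def HasVal (z : ℂ) (s : ℂ⟦X⟧) (v : ℂ) : Prop :=
  ∃ p d : Polynomial ℂ, d.eval z ≠ 0 ∧ s * (d : ℂ⟦X⟧) = p ∧ p.eval z = v * d.eval z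

namespace HasVal

variable {z : ℂ} {s s' : ℂ⟦X⟧} {v v' : ℂ}

theorem coe (z : ℂ) (p : Polynomial ℂ) : HasVal z (p : ℂ⟦X⟧) (p.eval z) :=
  ⟨p, 1, by simp, by simp, by simp⟩

theorem algebraMap (z c : ℂ) : HasVal z (algebraMap ℂ ℂ⟦X⟧ c) c := by
  simpa using coe z (Polynomial.C c)

theorem X (z : ℂ) : HasVal z PowerSeries.X z := by
  simpa using coe z Polynomial.X

theorem add (h : HasVal z s v) (h' : HasVal z s' v') : HasVal z (s + s') (v + v') := by
  obtain ⟨p, d, hd, h, hp⟩ := h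
  obtain ⟨p', d', hd', h', hp'⟩ := h'
  refine ⟨p * d' + p' * d, d * d', by simp [hd, hd'], ?_, ?_⟩
  · push_cast
    linear_combination (d' : ℂ⟦X⟧) * h + (d : ℂ⟦X⟧) * h'
  · simp only [Polynomial.eval_add, Polynomial.eval_mul]
    linear_combination (d'.eval z) * hp + (d.eval z) * hp'

theorem mul (h : HasVal z s v) (h' : HasVal z s' v') : HasVal z (s * s') (v * v') := by
  obtain ⟨p, d, hd, h, hp⟩ := h
  obtain ⟨p', d', hd', h', hp'⟩ := h'
  refine ⟨p * p', d * d', by simp [hd, hd'], ?_, ?_⟩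
  · push_cast
    rw [← h, ← h']
    ring
  · simp only [Polynomial.eval_mul]
    rw [hp, hp']
    ring

theorem pow (h : HasVal z s v) (k : ℕ) : HasVal z (s ^ k) (v ^ k) := by
  induction k with
  | zero => simpa using coe z 1
  | succ k ih => simpa [pow_succ] using ih.mul h

theorem sum {ι : Type*} (I : Finset ι) {f : ι → ℂ⟦X⟧} {g : ι → ℂ}
    (h : ∀ i, HasVal z (f i) (g i)) : HasVal z (∑ i ∈ I, f i) (∑ i ∈ I, g i) := by
  classical
  induction I using Finset.induction_on with
  | empty => simpa using coe z 0
  | insert i I hi ih =>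
    rw [Finset.sum_insert hi, Finset.sum_insert hi]
    exact (h i).add ih

/-- Two fractions for the same series agree after cross-multiplication, as polynomials, and
polynomials can be evaluated at z. This is what carries formal identities to values far from the
origin. -/
theorem unique (h : HasVal z s v) (h' : HasVal z s v') : v = v' := by
  obtain ⟨p, d, hd, h, hp⟩ := h
  obtain ⟨p', d', hd', h', hp'⟩ := h'
  have h1 : p * d' = p' * d := by
    apply Polynomial.coe_injective ℂ
    push_cast
    rw [← h, ← h']
    ring
  have h2 := congrArg (Polynomial.eval z) h1
  simp only [Polynomial.eval_mul, hp, hp'] at h2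
  have h3 : d.eval z * d'.eval z ≠ 0 := mul_ne_zero hd hd'
  apply mul_right_cancel₀ h3
  linear_combination h2

theorem of_hasExpansion {f : RatFunc ℂ} (h : HasExpansion f s) (hz : f.denom.eval z ≠ 0) :
    HasVal z s (f.eval (RingHom.id ℂ) z) := by
  refine ⟨f.num, f.denom, hz, h.symm, ?_⟩
  rw [RatFunc.eval, ← Polynomial.eval, ← Polynomial.eval, div_mul_cancel₀ _ hz]

end HasVal

/-- Matrix identities between rational power series may be evaluated at regular points. -/
theorem valueAt_mul_eq {n : ℕ} {K : Matrix (Conf n) (Conf n) (RatFunc ℂ)}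
    {G P Q : Matrix (Conf n) (Conf n) ℂ⟦X⟧} {P' Q' : Op n} {z : ℂ}
    (hK : ∀ β α, HasExpansion (K β α) (G β α)) (hz : IsRegularAt K z)
    (hP : ∀ β α, HasVal z (P β α) (P' β α)) (hQ : ∀ β α, HasVal z (Q β α) (Q' β α))
    (h : G * P = Q * G) : valueAt K z * P' = Q' * valueAt K z := by
  have hG : ∀ β α, HasVal z (G β α) (valueAt K z β α) := fun β α =>
    HasVal.of_hasExpansion (hK β α) (hz β α)
  ext β α
  have h1 : HasVal z ((G * P) β α) ((valueAt K z * P') β α) :=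
    HasVal.sum _ fun γ => (hG β γ).mul (hP γ α)
  have h2 : HasVal z ((Q * G) β α) ((Q' * valueAt K z) β α) :=
    HasVal.sum _ fun γ => (hQ β γ).mul (hG γ α)
  rw [h] at h1
  exact h1.unique h2

/-! ## Generators as bond operators -/

/-- The vector `a e_i + b e_j`. -/
def bond {n : ℕ} (i j : Fin n) (a b : ℤ) : Fin n → ℤ := Pi.single i a + Pi.single j b

/-- The operator `u |α⟩ ↦ |α - v⟩` plus `w |α⟩ ↦ |α + v⟩` plus `x k⁻¹`, with entries in `R`. -/
def bondOp {n : ℕ} {R : Type*} [CommRing R] [Algebra ℂ R] (p : ℂ) (v : Fin n → ℤ) (u w x : R) :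
    Matrix (Conf n) (Conf n) R :=
  Matrix.of fun β α => u * algebraMap ℂ R (shiftOp (-v) β α) + w * algebraMap ℂ R (shiftOp v β α) +
    x * algebraMap ℂ R (kInvOp p v β α)

/-- When α and β = α + v both lie in {0,1}ⁿ, each v_i (2β_i - 1) equals v_i². So k⁻¹ acts by p^{-r}
on the image of e, and the coefficient p^r cancels it: the generator is just f + e + d k⁻¹. -/
theorem onsagerOp_eq {n : ℕ} {p : ℂ} (hp : p ≠ 0) (d x : ℂ) {v : Fin n → ℤ} {r : ℕ}
    (hv : ∑ i, v i ^ 2 = r) : onsagerOp p (p ^ r) d v x = bondOp p v x⁻¹ x d := by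
  ext β α
  have h : p ^ r * (kInvOp p v * shiftOp v) β α = shiftOp v β α := by
    rw [kInvOp, Matrix.diagonal_mul]
    simp only [shiftOp, Matrix.of_apply]
    split_ifs with hs
    · have h1 : ∑ i, v i * (2 * ((β i : ℕ) : ℤ) - 1) = r := by
        rw [← hv]
        refine Finset.sum_congr rfl fun i _ => ?_
        have h1 := hs i
        have h2 : v i = ((β i : ℕ) : ℤ) - ((α i : ℕ) : ℤ) := by omega
        rw [h2]
        generalize β i = y
        generalize α i = y'
        fin_cases y <;> fin_cases y' <;> simp
      rw [h1, zpow_neg, zpow_natCast, mul_one, mul_inv_cancel₀ (pow_ne_zero _ hp)]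
    · simp
  simp only [onsagerOp, bondOp, fOp, eOp, Matrix.add_apply, Matrix.smul_apply, Matrix.of_apply,
    smul_eq_mul, Matrix.mul_smul, Algebra.algebraMap_self, RingHom.id_apply]
  linear_combination x * h

theorem HasVal.bondOp {n : ℕ} {z p : ℂ} {v : Fin n → ℤ} {u w x : ℂ⟦X⟧} {u' w' x' : ℂ}
    (hu : HasVal z u u') (hw : HasVal z w w') (hx : HasVal z x x') (β α : Conf n) :
    HasVal z (bondOp p v u w x β α) (bondOp p v u' w' x' β α) :=
  ((hu.mul (algebraMap z _)).add (hw.mul (algebraMap z _))).add (hx.mul (algebraMap z _))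

/-- The configuration `α` with `α_i`, `α_j` replaced by `c`, `d`. -/
def upd {n : ℕ} (i j : Fin n) (α : Conf n) (c d : Fin 2) : Conf n :=
  Function.update (Function.update α i c) j d

theorem sum_agree {n : ℕ} {i j : Fin n} (hij : i ≠ j) {M : Type*} [AddCommMonoid M]
    (α : Conf n) (F : Conf n → M) :
    (∑ γ : Conf n, if ∀ l, l ≠ i → l ≠ j → γ l = α l then F γ else 0) =
      ∑ c, ∑ d, F (upd i j α c d) := by
  rw [← Finset.sum_filter, ← Finset.sum_product']
  symm
  refine Finset.sum_bij' (fun x _ => upd i j α x.1 x.2) (fun γ _ => (γ i, γ j)) ?_ ?_ ?_ ?_ ?_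
  · rintro ⟨c, d⟩ _
    simp +contextual [upd, Function.update_of_ne]
  · simp
  · rintro ⟨c, d⟩ _
    simp [upd, hij]
  · intro γ hγ
    simp only [Finset.mem_filter, Finset.mem_univ, true_and] at hγ
    funext l
    by_cases h1 : l = j
    · subst h1
      simp [upd]
    · by_cases h2 : l = i
      · subst h2
        simp [upd, h1]
      · simp [upd, h1, h2, hγ l h2 h1]
  · simp

/-- The entries of `bondOp` on the two sites of the bond. -/
def bondLoc {R : Type*} [CommRing R] [Algebra ℂ R] (p : ℂ) (a b : ℤ) (u w x : R)
    (c d c' d' : Fin 2) : R :=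
  (if ((c : ℕ) : ℤ) = (c' : ℕ) - a ∧ ((d : ℕ) : ℤ) = (d' : ℕ) - b then u else 0) +
  (if ((c : ℕ) : ℤ) = (c' : ℕ) + a ∧ ((d : ℕ) : ℤ) = (d' : ℕ) + b then w else 0) +
  (if c = c' ∧ d = d' then
    x * algebraMap ℂ R (p ^ (-(a * (2 * ((c' : ℕ) : ℤ) - 1) + b * (2 * ((d' : ℕ) : ℤ) - 1))))
  else 0)

theorem forall_add_bond {n : ℕ} {i j : Fin n} (hij : i ≠ j) (a b : ℤ) (β α : Conf n) :
    (∀ l, ((β l : ℕ) : ℤ) = ((α l : ℕ) : ℤ) + bond i j a b l) ↔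
      (∀ l, l ≠ i → l ≠ j → β l = α l) ∧
        ((β i : ℕ) : ℤ) = (α i : ℕ) + a ∧ ((β j : ℕ) : ℤ) = (α j : ℕ) + b := by
  constructor
  · intro h
    refine ⟨fun l hi hj => ?_, ?_, ?_⟩
    · have := h l
      simp only [bond, Pi.add_apply, Pi.single_apply, hi, hj, if_false, add_zero] at this
      exact Fin.ext (by exact_mod_cast this)
    · simpa [bond, Pi.single_apply, hij] using h i
    · simpa [bond, Pi.single_apply, hij.symm] using h j
  · rintro ⟨h, hi, hj⟩ l
    by_cases h1 : l = i
    · subst h1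
      simpa [bond, Pi.single_apply, hij] using hi
    · by_cases h2 : l = j
      · subst h2
        simpa [bond, Pi.single_apply, hij.symm] using hj
      · simp [bond, h1, h2, h l h1 h2]

theorem sum_bond_mul {n : ℕ} (i j : Fin n) (a b : ℤ) (f : Fin n → ℤ) :
    ∑ l, bond i j a b l * f l = a * f i + b * f j := by
  simp [bond, Pi.single_apply, add_mul, Finset.sum_add_distrib]

theorem bondOp_apply {n : ℕ} {R : Type*} [CommRing R] [Algebra ℂ R] (p : ℂ) {i j : Fin n}
    (hij : i ≠ j) (a b : ℤ) (u w x : R) (β α : Conf n) :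
    bondOp p (bond i j a b) u w x β α =
      if ∀ l, l ≠ i → l ≠ j → β l = α l then
        bondLoc p a b u w x (β i) (β j) (α i) (α j) else 0 := by
  have hneg : -bond i j a b = bond i j (-a) (-b) := by
    rw [bond, bond, neg_add, Pi.single_neg, Pi.single_neg]
  have heq : β = α ↔ (∀ l, l ≠ i → l ≠ j → β l = α l) ∧ β i = α i ∧ β j = α j := by
    constructor
    · rintro rfl
      simp
    · rintro ⟨h, hi, hj⟩
      funext l
      by_cases h1 : l = i
      · rw [h1, hi]
      · by_cases h2 : l = j
        · rw [h2, hj]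
        · exact h l h1 h2
  simp only [bondOp, bondLoc, shiftOp, kInvOp, Matrix.of_apply, hneg, forall_add_bond hij,
    Matrix.diagonal_apply, sum_bond_mul, ← sub_eq_add_neg, heq]
  by_cases h : ∀ l, l ≠ i → l ≠ j → β l = α l
  · simp only [eq_true h, true_and, if_true]
    congr 1
    · congr 1 <;> split_ifs <;> simp
    · by_cases h' : β i = α i ∧ β j = α j
      · simp only [h', and_self, if_true]
      · simp only [h', if_false, map_zero, mul_zero]
  · simp only [h, false_and, if_false, map_zero, mul_zero, add_zero]

/-- Commutation with bond operators is a condition on the two sites. -/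
theorem bondOp_intertwine {n : ℕ} {R : Type*} [CommRing R] [Algebra ℂ R] (p : ℂ) {i j : Fin n}
    (hij : i ≠ j) (a b : ℤ) (u w x u' w' x' : R) (G : Matrix (Conf n) (Conf n) R)
    (h : ∀ β α, ∑ c, ∑ d, G β (upd i j α c d) * bondLoc p a b u w x c d (α i) (α j) =
      ∑ c, ∑ d, bondLoc p a b u' w' x' (β i) (β j) c d * G (upd i j β c d) α) :
    G * bondOp p (bond i j a b) u w x = bondOp p (bond i j a b) u' w' x' * G := by
  have hi : ∀ (α : Conf n) c d, upd i j α c d i = c := by simp [upd, hij]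
  have hj : ∀ (α : Conf n) c d, upd i j α c d j = d := by simp [upd]
  ext β α
  rw [Matrix.mul_apply, Matrix.mul_apply]
  simp only [bondOp_apply p hij, mul_ite, mul_zero, ite_mul, zero_mul]
  rw [sum_agree hij α fun γ => G β γ * bondLoc p a b u w x (γ i) (γ j) (α i) (α j)]
  simp only [eq_comm (a := β _)]
  rw [sum_agree hij β fun γ => bondLoc p a b u' w' x' (β i) (β j) (γ i) (γ j) * G γ α]
  simpa only [hi, hj] using h β α

theorem upd_self {n : ℕ} (i j : Fin n) (α : Conf n) : upd i j α (α i) (α j) = α := by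
  funext l
  by_cases h1 : l = j
  · subst h1
    simp [upd]
  · by_cases h2 : l = i
    · subst h2
      simp [upd, h1]
    · simp [upd, h1]

/-! ## The two sites of a bond in the matrix product -/

/-- Only two adjacent factors see the spins of a bond. The clauses A = 1 and B = 1 say that at an
end of the chain nothing separates these factors from the boundary vector. -/
theorem prodK_upd (q : ℂ) {n : ℕ} (i j : Fin n) (hij : (i : ℕ) + 1 = j) (β α : Conf n) :
    ∃ A B : Module.End ℂ Fock, ((i : ℕ) = 0 → A = 1) ∧ ((j : ℕ) + 1 = n → B = 1) ∧
      ∀ c d c' d', prodK q (upd i j β c d) (upd i j α c' d') =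
        A * locK q c c' * locK q d d' * B := by
  obtain ⟨r, hr⟩ : ∃ r, n = i + (r + 2) := ⟨n - i - 2, by omega⟩
  obtain ⟨i, hi⟩ := i
  obtain ⟨j, hj⟩ := j
  simp only at hij hr
  subst hij hr
  refine ⟨(List.ofFn fun l : Fin i => locK q (β (Fin.castLE (Nat.le_add_right _ _) l))
      (α (Fin.castLE (Nat.le_add_right _ _) l))).prod,
    (List.ofFn fun l : Fin r => locK q (β (Fin.natAdd i l.succ.succ))
      (α (Fin.natAdd i l.succ.succ))).prod, ?_, ?_, ?_⟩
  · intro h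
    simp only at h
    subst h
    simp
  · intro h
    have : r = 0 := by simp only at h; omega
    subst this
    simp
  · intro c d c' d'
    have h1 : ∀ l : Fin i, ∀ (γ : Conf (i + (r + 2))) c d,
        upd ⟨i, hi⟩ ⟨i + 1, hj⟩ γ c d (Fin.castLE (Nat.le_add_right _ _) l) =
          γ (Fin.castLE (Nat.le_add_right _ _) l) := by
      intro l γ c d
      rw [upd, Function.update_of_ne, Function.update_of_ne] <;>
      · simp only [Ne, Fin.ext_iff, Fin.val_castLE]
        omega
    have h2 : ∀ l : Fin r, ∀ (γ : Conf (i + (r + 2))) c d,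
        upd ⟨i, hi⟩ ⟨i + 1, hj⟩ γ c d (Fin.natAdd i l.succ.succ) =
          γ (Fin.natAdd i l.succ.succ) := by
      intro l γ c d
      rw [upd, Function.update_of_ne, Function.update_of_ne] <;>
      · simp only [Ne, Fin.ext_iff, Fin.val_natAdd, Fin.val_succ]
        omega
    have h3 : ∀ (γ : Conf (i + (r + 2))) c d,
        upd ⟨i, hi⟩ ⟨i + 1, hj⟩ γ c d (Fin.natAdd i 0) = c := by
      intro γ c d
      have : (Fin.natAdd i 0 : Fin (i + (r + 2))) = ⟨i, hi⟩ := by simp [Fin.ext_iff]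
      rw [this, upd, Function.update_of_ne, Function.update_self]
      simp [Fin.ext_iff]
    have h4 : ∀ (γ : Conf (i + (r + 2))) c d,
        upd ⟨i, hi⟩ ⟨i + 1, hj⟩ γ c d (Fin.natAdd i (Fin.succ 0)) = d := by
      intro γ c d
      have : (Fin.natAdd i (Fin.succ 0) : Fin (i + (r + 2))) = ⟨i + 1, hj⟩ := by
        simp [Fin.ext_iff]
      rw [this, upd, Function.update_self]
    rw [prodK, List.ofFn_add, List.prod_append, List.ofFn_succ, List.ofFn_succ, List.prod_cons,
      List.prod_cons]
    simp only [h1, h2, h3, h4, mul_assoc]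

/-- The matrix product with its last and first factor split off. -/
theorem prodK_upd_wrap (q : ℂ) {n : ℕ} (i j : Fin n) (hi : (i : ℕ) + 1 = n) (hj : (j : ℕ) = 0)
    (hij : i ≠ j) (β α : Conf n) :
    ∃ Y : Module.End ℂ Fock, ∀ c d c' d', prodK q (upd i j β c d) (upd i j α c' d') =
      locK q d d' * Y * locK q c c' := by
  obtain ⟨r, rfl⟩ : ∃ r, n = (r + 1) + 1 := ⟨n - 2, by
    have : (i : ℕ) ≠ j := fun h => hij (Fin.ext h)
    omega⟩
  obtain rfl : j = 0 := Fin.ext hj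
  obtain rfl : i = (Fin.last r).succ := Fin.ext (by simp; omega)
  refine ⟨(List.ofFn fun l : Fin r => locK q (β l.castSucc.succ) (α l.castSucc.succ)).prod, ?_⟩
  intro c d c' d'
  have h1 : ∀ (γ : Conf (r + 1 + 1)) c d, upd (Fin.last r).succ 0 γ c d 0 = d := by
    simp [upd]
  have h2 : ∀ (γ : Conf (r + 1 + 1)) c d,
      upd (Fin.last r).succ 0 γ c d (Fin.last r).succ = c := by
    simp [upd]
  have h3 : ∀ (γ : Conf (r + 1 + 1)) c d (l : Fin r),
      upd (Fin.last r).succ 0 γ c d l.castSucc.succ = γ l.castSucc.succ := by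
    intro γ c d l
    rw [upd, Function.update_of_ne (Fin.succ_ne_zero _), Function.update_of_ne]
    simp only [Ne, Fin.ext_iff, Fin.val_succ, Fin.val_castSucc, Fin.val_last]
    omega
  rw [prodK, List.ofFn_succ, List.prod_cons, List.ofFn_succ', List.concat_eq_append,
    List.prod_append, List.prod_singleton]
  simp only [h1, h2, h3, mul_assoc]

/-! ## The `q`-boson algebra -/

section
variable (q : ℂ)

@[simp] theorem locK_zero_zero : locK q 0 0 = aPlus := rfl
@[simp] theorem locK_zero_one : locK q 0 1 = (-q) • kBoson q :=
  (neg_smul q (kBoson q)).symm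
@[simp] theorem locK_one_zero : locK q 1 0 = kBoson q := rfl
@[simp] theorem locK_one_one : locK q 1 1 = aMinus q := rfl

theorem aPlus_apply (v : Fock) (m : ℕ) : aPlus v m = if m = 0 then 0 else v (m - 1) := rfl
theorem aMinus_apply (v : Fock) (m : ℕ) : aMinus q v m = (1 - q ^ (2 * (m + 1))) * v (m + 1) := rfl
theorem kBoson_apply (v : Fock) (m : ℕ) : kBoson q v m = q ^ m * v m := rfl

theorem kBoson_mul_aPlus : kBoson q * aPlus = q • (aPlus * kBoson q) := by
  ext v m
  cases m <;> simp [aPlus_apply, kBoson_apply]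
  ring

theorem aMinus_mul_kBoson : aMinus q * kBoson q = q • (kBoson q * aMinus q) := by
  ext v m
  simp [aMinus_apply, kBoson_apply]
  ring

theorem aPlus_mul_aMinus : aPlus * aMinus q = 1 - kBoson q * kBoson q := by
  ext v m
  cases m <;> simp [aPlus_apply, aMinus_apply, kBoson_apply]
  ring

theorem aMinus_mul_aPlus : aMinus q * aPlus = 1 - q ^ 2 • (kBoson q * kBoson q) := by
  ext v m
  simp [aPlus_apply, aMinus_apply, kBoson_apply]
  ring

end

/-- The relations between `p`, `q` and the coefficient `d` of the generators with `r = 2`. -/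
structure Params (p q d : ℂ) : Prop where
  p_ne : p ≠ 0
  q_ne : q ≠ 0
  mul_sq : d * p ^ 2 = d - q⁻¹
  mul_sq_inv : d * (p ^ 2)⁻¹ = d - q

/-! ### Local intertwining identities: bulk, right end and left end. -/

section local_identities

variable {p q d : ℂ}

/-- Sixteen cases. The q-boson relations reduce each to a comparison of coefficients, where `Params`
has eliminated d p² and d p⁻². No vector or functional enters, so the same identity serves the trace
and all boundary types. -/
theorem locK_bulk (h : Params p q d) (c e c' e' : Fin 2) :
    ∑ a, ∑ b, bondLoc p (-1) 1 1 1 d a b c' e' • (locK q c a * locK q e b) =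
      ∑ a, ∑ b, bondLoc p (-1) 1 1 1 d c e a b • (locK q a c' * locK q b e') := by
  obtain ⟨hp, hq, h1, h2⟩ := h
  revert c e c' e'
  simp [Fin.forall_fin_two, Fin.sum_univ_two, bondLoc, zpow_ofNat, -neg_smul]
  simp only [h1, h2, kBoson_mul_aPlus, aMinus_mul_kBoson, aPlus_mul_aMinus, aMinus_mul_aPlus]
  and_intros <;> match_scalars <;> field_simp <;> ring

/-- The only input on |η_2⟩ is a⁻η = a⁺η. The coefficients -q⁻¹ and -q are those that conjugation by
S turns into 1, since (i q^{1/2})² = -q. -/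
theorem locK_right_two (h : Params p q d) {η : Fock} (hη : aMinus q η = aPlus η)
    (c e c' e' : Fin 2) :
    ∑ a, ∑ b, bondLoc p (-1) (-1) (-q⁻¹) (-q) d a b c' e' • (locK q c a * locK q e b) η =
      ∑ a, ∑ b, bondLoc p (-1) (-1) (-q⁻¹) (-q) d c e a b • (locK q a c' * locK q b e') η := by
  obtain ⟨hp, hq, h1, h2⟩ := h
  have hk : aPlus (kBoson q η) = q⁻¹ • kBoson q (aPlus η) := by
    have := congrArg (fun f => f η) (kBoson_mul_aPlus q)
    simp at this
    rw [this, smul_smul, inv_mul_cancel₀ hq, one_smul]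
  have hk' : aMinus q (kBoson q η) = q • kBoson q (aPlus η) := by
    have := congrArg (fun f => f η) (aMinus_mul_kBoson q)
    simpa [hη] using this
  have ha : aPlus (aPlus η) = η - kBoson q (kBoson q η) := by
    have := congrArg (fun f => f η) (aPlus_mul_aMinus q)
    simpa [hη] using this
  have ha' : aMinus q (aPlus η) = η - q ^ 2 • kBoson q (kBoson q η) := by
    have := congrArg (fun f => f η) (aMinus_mul_aPlus q)
    simpa [hη] using this
  revert c e c' e'
  simp [Fin.forall_fin_two, Fin.sum_univ_two, bondLoc, zpow_ofNat, hη, hk, hk', ha, ha']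
  simp only [h1, h2]
  and_intros <;> match_scalars <;> field_simp <;> ring

/-- F stands for ⟨η_2|z^h · |η_k'⟩. The coefficients are those of z² b_0(z) on one side and z²
b_0(z⁻¹) on the other, before the gauge; the factor z² removes negative powers of z. -/
theorem locK_left_two (h : Params p q d) (F : Module.End ℂ Fock →ₗ[ℂ] ℂ⟦X⟧)
    (hF : ∀ Y, F (aPlus * Y) = PowerSeries.X ^ 2 * F (aMinus q * Y)) (Y : Module.End ℂ Fock)
    (c e c' e' : Fin 2) :
    ∑ a, ∑ b, F (locK q c a * locK q e b * Y) *
      bondLoc p 1 1 (PowerSeries.C (-q)) (PowerSeries.X ^ 4 * PowerSeries.C (-q⁻¹))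
        (PowerSeries.X ^ 2 * PowerSeries.C d) a b c' e' =
      ∑ a, ∑ b, bondLoc p 1 1 (PowerSeries.X ^ 4 * PowerSeries.C (-q)) (PowerSeries.C (-q⁻¹))
        (PowerSeries.X ^ 2 * PowerSeries.C d) c e a b * F (locK q a c' * locK q b e' * Y) := by
  obtain ⟨hp, hq, h1, h2⟩ := h
  have hQ : PowerSeries.C q * PowerSeries.C q⁻¹ = 1 := by
    rw [← map_mul, mul_inv_cancel₀ hq, map_one]
  have h1 := congrArg PowerSeries.C h1
  have h2 := congrArg PowerSeries.C h2
  have e1 : F (aPlus * (kBoson q * Y)) = PowerSeries.X ^ 2 * F (aMinus q * (kBoson q * Y)) := hF _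
  have e2 : F (kBoson q * (aPlus * Y)) =
      PowerSeries.C q * PowerSeries.X ^ 2 * F (aMinus q * (kBoson q * Y)) := by
    rw [← mul_assoc, kBoson_mul_aPlus, smul_mul_assoc, map_smul, mul_assoc, hF,
      PowerSeries.smul_eq_C_mul, mul_assoc]
  have e3 : F (aMinus q * (kBoson q * Y)) = PowerSeries.C q * F (kBoson q * (aMinus q * Y)) := by
    rw [← mul_assoc, aMinus_mul_kBoson, smul_mul_assoc, map_smul, mul_assoc,
      PowerSeries.smul_eq_C_mul]
  have e4 : F (aPlus * (aPlus * Y)) =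
      PowerSeries.X ^ 2 * (F Y - PowerSeries.C q ^ 2 * F (kBoson q * (kBoson q * Y))) := by
    rw [hF, ← mul_assoc (aMinus q), aMinus_mul_aPlus, sub_mul, map_sub, smul_mul_assoc, map_smul,
      mul_assoc, PowerSeries.smul_eq_C_mul, one_mul, map_pow]
  have e5 : PowerSeries.X ^ 2 * F (aMinus q * (aMinus q * Y)) =
      F Y - F (kBoson q * (kBoson q * Y)) := by
    rw [← hF, ← mul_assoc, aPlus_mul_aMinus, sub_mul, map_sub, one_mul, mul_assoc]
  have e6 : F (aPlus * (aMinus q * Y)) = F Y - F (kBoson q * (kBoson q * Y)) := by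
    rw [← e5, hF]
  have e7 : F (aMinus q * (aPlus * Y)) =
      F Y - PowerSeries.C q ^ 2 * F (kBoson q * (kBoson q * Y)) := by
    rw [← mul_assoc (aMinus q), aMinus_mul_aPlus, sub_mul, map_sub, smul_mul_assoc, map_smul,
      mul_assoc, PowerSeries.smul_eq_C_mul, one_mul, map_pow]
  revert c e c' e'
  simp [Fin.forall_fin_two, Fin.sum_univ_two, bondLoc, zpow_ofNat, mul_assoc,
    -neg_smul, -map_pow]
  simp only [PowerSeries.smul_eq_C_mul, map_neg]
  rw [map_mul, map_sub] at h1 h2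
  rw [e1, e2, e3, e4, e6, e7]
  clear hF e1 e2 e3 e4 e6 e7
  -- From here on this is commutative algebra: the values of F and the constants become
  -- indeterminates, A, Q' and Q are eliminated linearly, and Q Q' = 1 is the only relation left.
  generalize F (aMinus q * (aMinus q * Y)) = M at *
  generalize F (kBoson q * (aMinus q * Y)) = Z at *
  generalize F (kBoson q * (kBoson q * Y)) = B at *
  generalize F Y = A at *
  generalize (PowerSeries.C (p ^ 2) : ℂ⟦X⟧) = P at *
  generalize (PowerSeries.C (p ^ 2)⁻¹ : ℂ⟦X⟧) = P' at *
  generalize (PowerSeries.C q : ℂ⟦X⟧) = Q at *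
  generalize (PowerSeries.C q⁻¹ : ℂ⟦X⟧) = Q' at *
  generalize (PowerSeries.C d : ℂ⟦X⟧) = D at *
  generalize (PowerSeries.X : ℂ⟦X⟧) = x at *
  obtain rfl : A = x ^ 2 * M + B := by rw [e5]; ring
  obtain rfl : Q' = D - D * P := by rw [h1]; ring
  obtain rfl : Q = D - D * P' := by rw [h2]; ring
  clear e5 h1 h2
  and_intros
  · linear_combination -(x ^ 4 * (D - D * P') * B) * hQ
  · linear_combination -(x ^ 4 * (D - D * P') * Z) * hQ
  · linear_combination -(x ^ 4 * (D - D * P') ^ 2 * Z) * hQ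
  · linear_combination x ^ 2 * (D - D * P') * B * hQ
  · ring
  · ring
  · ring
  · ring
  · ring
  · ring
  · ring
  · ring
  · linear_combination -(x ^ 2 * (D - D * P') * B) * hQ
  · linear_combination -(x ^ 2 * (D - D * P') * Z) * hQ
  · linear_combination -(x ^ 2 * (D - D * P') ^ 2 * Z) * hQ
  · linear_combination (D - D * P') * B * hQ

/-- The restriction of `bondLoc` with `a = 0` to the second site. -/
def siteLoc {R : Type*} [CommRing R] [Algebra ℂ R] (p : ℂ) (b : ℤ) (u w x : R)
    (d d' : Fin 2) : R :=
  (if ((d : ℕ) : ℤ) = (d' : ℕ) - b then u else 0) + (if ((d : ℕ) : ℤ) = (d' : ℕ) + b then w else 0) +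
  (if d = d' then x * algebraMap ℂ R (p ^ (-(b * (2 * ((d' : ℕ) : ℤ) - 1)))) else 0)

/-- A one-site boundary generator is treated as a bond with a spectator site, so that the two-site
framework covers it as well. -/
theorem bondLoc_zero_left {R : Type*} [CommRing R] [Algebra ℂ R] (p : ℂ) (b : ℤ) (u w x : R)
    (c d c' d' : Fin 2) :
    bondLoc p 0 b u w x c d c' d' = if c = c' then siteLoc p b u w x d d' else 0 := by
  have h : ((c : ℕ) : ℤ) = (c' : ℕ) ↔ c = c' := by rw [Nat.cast_inj, Fin.val_inj]
  by_cases hc : c = c' <;> simp [bondLoc, siteLoc, h, hc]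

theorem bondLoc_zero_right {R : Type*} [CommRing R] [Algebra ℂ R] (p : ℂ) (b : ℤ) (u w x : R)
    (c d c' d' : Fin 2) :
    bondLoc p b 0 u w x c d c' d' = if d = d' then siteLoc p b u w x c c' else 0 := by
  have h : ((d : ℕ) : ℤ) = (d' : ℕ) ↔ d = d' := by rw [Nat.cast_inj, Fin.val_inj]
  by_cases hc : d = d' <;> simp [bondLoc, siteLoc, h, hc]

/-- The relations between `p`, `q`, the coefficient `d` of the generators with `r = 1` and the
gauge factor `g`. -/
structure Params₁ (p q d g : ℂ) : Prop where
  g_ne : g ≠ 0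
  sq : g ^ 2 = -q
  mul_sub : d * (p - p⁻¹) = g⁻¹ * (1 + q)

/-- The relations of |η_1⟩ put every term in the span of η and kη. The coefficients match by g⁻¹q =
-g and the relation for d(p - p⁻¹). -/
theorem locK_right_site {g : ℂ} (h : Params₁ p q d g) {η : Fock}
    (h₁ : aPlus η = η - kBoson q η) (h₂ : aMinus q η = η + q • kBoson q η) (e e' : Fin 2) :
    ∑ b, siteLoc p (-1) g⁻¹ g d b e' • locK q e b η =
      ∑ b, siteLoc p (-1) g⁻¹ g d e b • locK q b e' η := by
  obtain ⟨hg, hq, h⟩ := h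
  have hq' : g⁻¹ * q = -g := by
    field_simp
    linear_combination hq
  revert e e'
  simp [Fin.forall_fin_two, Fin.sum_univ_two, siteLoc, h₁, h₂, -neg_smul]
  and_intros
  · match_scalars
    linear_combination -hq'
  · match_scalars
    · ring
    · linear_combination -q * h - (1 + q) * hq'
  · match_scalars
    · linear_combination -h
    · ring
  · match_scalars
    linear_combination hq'

theorem locK_right_one {g : ℂ} (h : Params₁ p q d g) {η : Fock}
    (h₁ : aPlus η = η - kBoson q η) (h₂ : aMinus q η = η + q • kBoson q η)
    (c e c' e' : Fin 2) :
    ∑ a, ∑ b, bondLoc p 0 (-1) g⁻¹ g d a b c' e' • (locK q c a * locK q e b) η =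
      ∑ a, ∑ b, bondLoc p 0 (-1) g⁻¹ g d c e a b • (locK q a c' * locK q b e') η := by
  have := congrArg (locK q c c') (locK_right_site h h₁ h₂ e e')
  simpa [bondLoc_zero_left, ite_smul, Finset.sum_ite_irrel] using this

/-- The mirror image of `locK_right_site`, with the coefficients of z b_0(z) and z b_0(z⁻¹) before
the gauge. The relation for a⁻ keeps its factor z on the left because z is not invertible among
power series. -/
theorem locK_left_site {g : ℂ} (h : Params₁ p q d g) (F : Module.End ℂ Fock →ₗ[ℂ] ℂ⟦X⟧)
    (h₁ : ∀ Y, F (aPlus * Y) = PowerSeries.X * (F Y + PowerSeries.C q * F (kBoson q * Y)))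
    (h₂ : ∀ Y, PowerSeries.X * F (aMinus q * Y) = F Y - F (kBoson q * Y))
    (Y : Module.End ℂ Fock) (c c' : Fin 2) :
    ∑ a, F (locK q c a * Y) *
      siteLoc p 1 (PowerSeries.C g) (PowerSeries.X ^ 2 * PowerSeries.C g⁻¹)
        (PowerSeries.X * PowerSeries.C d) a c' =
      ∑ a, siteLoc p 1 (PowerSeries.X ^ 2 * PowerSeries.C g) (PowerSeries.C g⁻¹)
        (PowerSeries.X * PowerSeries.C d) c a * F (locK q a c' * Y) := by
  obtain ⟨hg, hq, h⟩ := h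
  have hq' : g⁻¹ * q = -g := by
    field_simp
    linear_combination hq
  have h := congrArg (PowerSeries.C : ℂ → ℂ⟦X⟧) h
  have hq' := congrArg (PowerSeries.C : ℂ → ℂ⟦X⟧) hq'
  revert c c'
  simp [Fin.forall_fin_two, Fin.sum_univ_two, siteLoc, h₁, -neg_smul, PowerSeries.smul_eq_C_mul]
  simp only [map_mul, map_sub, map_neg, map_add, map_one] at h hq'
  and_intros
  · linear_combination -(PowerSeries.X ^ 2 * F (kBoson q * Y)) * hq'
  · linear_combination PowerSeries.X * F (kBoson q * Y) *
      (PowerSeries.C q * h + (1 + PowerSeries.C q) * hq') -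
      PowerSeries.X * PowerSeries.C g * h₂ Y
  · linear_combination PowerSeries.X * F (kBoson q * Y) * h +
      PowerSeries.X * PowerSeries.C g⁻¹ * h₂ Y
  · linear_combination F (kBoson q * Y) * hq'

theorem locK_left_one {g : ℂ} (h : Params₁ p q d g) (F : Module.End ℂ Fock →ₗ[ℂ] ℂ⟦X⟧)
    (h₁ : ∀ Y, F (aPlus * Y) = PowerSeries.X * (F Y + PowerSeries.C q * F (kBoson q * Y)))
    (h₂ : ∀ Y, PowerSeries.X * F (aMinus q * Y) = F Y - F (kBoson q * Y))
    (Y : Module.End ℂ Fock) (c e c' e' : Fin 2) :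
    ∑ a, ∑ b, F (locK q c a * locK q e b * Y) *
      bondLoc p 1 0 (PowerSeries.C g) (PowerSeries.X ^ 2 * PowerSeries.C g⁻¹)
        (PowerSeries.X * PowerSeries.C d) a b c' e' =
      ∑ a, ∑ b, bondLoc p 1 0 (PowerSeries.X ^ 2 * PowerSeries.C g) (PowerSeries.C g⁻¹)
        (PowerSeries.X * PowerSeries.C d) c e a b * F (locK q a c' * locK q b e' * Y) := by
  simpa [bondLoc_zero_right, mul_assoc] using locK_left_site h F h₁ h₂ (locK q e e' * Y) c c'

end local_identities

/-! ## Boundary vectors -/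

/-- The squared norm `⟨m|m⟩`. -/
abbrev normSq (q : ℂ) (m : ℕ) : ℂ := qPoch (q ^ 2) (q ^ 2) m

theorem qPoch_succ (x q : ℂ) (m : ℕ) : qPoch x q (m + 1) = qPoch x q m * (1 - x * q ^ m) :=
  Finset.prod_range_succ _ _

theorem normSq_succ (q : ℂ) (m : ℕ) :
    normSq q (m + 1) = normSq q m * (1 - q ^ (2 * (m + 1))) := by
  rw [normSq, qPoch_succ]
  ring_nf

theorem eta_zero (q : ℂ) (k : ℕ) : eta q k 0 = 1 := by
  simp [eta, qPoch]

section
variable {q : ℂ} (hq : ∀ m : ℕ, 0 < m → q ^ m ≠ 1)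
include hq

/-- The last factor of (q^{k²}; q^{k²})_{l+1} is 1 - q^{k(m+k)} for m = kl, and it is nonzero as q
is not a root of unity. The properties of the boundary vectors below rest on this recursion. -/
theorem eta_add {k : ℕ} (hk : 0 < k) (m : ℕ) :
    eta q k (m + k) * (1 - q ^ (k * (m + k))) = eta q k m := by
  by_cases h : k ∣ m
  · obtain ⟨l, rfl⟩ := h
    have h1 : (k * l + k) / k = l + 1 := by
      rw [Nat.add_div_right _ hk, Nat.mul_div_cancel_left _ hk]
    have h2 : q ^ k ^ 2 * (q ^ k ^ 2) ^ l = q ^ (k * (k * l + k)) := by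
      rw [← pow_mul, ← pow_add]
      ring_nf
    have h3 : (1 : ℂ) - q ^ (k * (k * l + k)) ≠ 0 :=
      sub_ne_zero.mpr (hq _ (by positivity)).symm
    simp only [eta, Nat.dvd_mul_right, if_true, h1, Nat.mul_div_cancel_left _ hk, qPoch_succ, h2,
      Nat.dvd_add_self_right]
    rw [mul_inv, mul_assoc, inv_mul_cancel₀ h3, mul_one]
  · simp [eta, h]

theorem eta_one_succ (m : ℕ) : eta q 1 (m + 1) * (1 - q ^ (m + 1)) = eta q 1 m := by
  simpa using eta_add hq one_pos m

theorem eta_two_add_two (m : ℕ) : eta q 2 (m + 2) * (1 - q ^ (2 * (m + 2))) = eta q 2 m :=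
  eta_add hq two_pos m

omit hq in
theorem eta_two_one : eta q 2 1 = 0 := by
  simp [eta]

omit hq in
theorem eta_two_mul_succ (m : ℕ) : eta q 2 (m + 1) * eta q 2 m = 0 := by
  by_cases h : 2 ∣ m
  · have : ¬ 2 ∣ m + 1 := by omega
    simp [eta, this]
  · simp [eta, h]

theorem aPlus_eta_one : aPlus (eta q 1) = eta q 1 - kBoson q (eta q 1) := by
  ext m
  cases m with
  | zero => simp [aPlus_apply, kBoson_apply]
  | succ m =>
    simp [aPlus_apply, kBoson_apply]
    linear_combination -eta_one_succ hq m

/-- The factor 1 - q^{2(m+1)} of a⁻ splits as (1 - q^{m+1})(1 + q^{m+1}), and the recursion absorbs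
the first half. -/
theorem aMinus_eta_one : aMinus q (eta q 1) = eta q 1 + q • kBoson q (eta q 1) := by
  ext m
  simp [aMinus_apply, kBoson_apply]
  linear_combination (1 + q ^ (m + 1)) * eta_one_succ hq m

theorem aMinus_eta_two : aMinus q (eta q 2) = aPlus (eta q 2) := by
  ext m
  cases m with
  | zero => simp [aPlus_apply, aMinus_apply, eta_two_one]
  | succ m =>
    simp [aPlus_apply, aMinus_apply]
    linear_combination eta_two_add_two hq m

end

/-! ## Matrix elements as linear functionals -/

/-- `traceZ` as a linear map. -/
def traceLin : Module.End ℂ Fock →ₗ[ℂ] ℂ⟦X⟧ where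
  toFun := traceZ
  map_add' A B := by ext; simp [traceZ]
  map_smul' c A := by ext; simp [traceZ]

/-- The matrix element of a vector with the left boundary vector. -/
def bdryVec (q : ℂ) (k : ℕ) : Fock →ₗ[ℂ] ℂ⟦X⟧ where
  toFun v := PowerSeries.mk fun m => eta q k m * normSq q m * v m
  map_add' A B := by ext; simp [mul_add]
  map_smul' c A := by ext; simp [mul_left_comm]

/-- `bdry` as a linear map. -/
def bdryLin (q : ℂ) (k k' : ℕ) : Module.End ℂ Fock →ₗ[ℂ] ℂ⟦X⟧ :=
  bdryVec q k ∘ₗ LinearMap.applyₗ (eta q k')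

theorem traceLin_apply (Y : Module.End ℂ Fock) : traceLin Y = traceZ Y := rfl

theorem bdryLin_apply (q : ℂ) (k k' : ℕ) (Y : Module.End ℂ Fock) :
    bdryLin q k k' Y = bdry q k k' Y := rfl

theorem bdryLin_eq (q : ℂ) (k k' : ℕ) (Y : Module.End ℂ Fock) :
    bdryLin q k k' Y = bdryVec q k (Y (eta q k')) := rfl

theorem coeff_bdryVec (q : ℂ) (k : ℕ) (v : Fock) (m : ℕ) :
    PowerSeries.coeff m (bdryVec q k v) = eta q k m * normSq q m * v m :=
  PowerSeries.coeff_mk m fun m => eta q k m * normSq q m * v m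

theorem aPlus_single (m : ℕ) : aPlus (Pi.single m 1) = Pi.single (m + 1) 1 := by
  ext l
  cases l <;> simp [aPlus_apply, Pi.single_apply]

theorem aMinus_single_zero (q : ℂ) : aMinus q (Pi.single 0 1) = 0 := by
  ext l
  simp [aMinus_apply]

theorem aMinus_single_succ (q : ℂ) (m : ℕ) :
    aMinus q (Pi.single (m + 1) 1) = (1 - q ^ (2 * (m + 1))) • Pi.single m (1 : ℂ) := by
  ext l
  simp only [aMinus_apply, Pi.single_apply, Pi.smul_apply, smul_eq_mul, Nat.add_right_cancel_iff]
  split_ifs with h <;> simp [h]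

theorem kBoson_single (q : ℂ) (m : ℕ) :
    kBoson q (Pi.single m 1) = q ^ m • Pi.single m (1 : ℂ) := by
  ext l
  simp only [kBoson_apply, Pi.single_apply, Pi.smul_apply, smul_eq_mul]
  split_ifs with h <;> simp [h]

/-- Cyclicity holds one diagonal entry at a time: moving a⁺ around shifts the index m by one, that
is, costs a factor z. No infinite sum is rearranged, so Y may be arbitrary. -/
theorem traceLin_aPlus_mul (Y : Module.End ℂ Fock) :
    traceLin (aPlus * Y) = PowerSeries.X * traceLin (Y * aPlus) := by
  ext m
  cases m with
  | zero => simp [traceLin_apply, traceZ, aPlus_apply]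
  | succ m =>
    rw [PowerSeries.coeff_succ_X_mul]
    simp [traceLin_apply, traceZ, aPlus_apply, aPlus_single]

theorem traceLin_aMinus_mul (q : ℂ) (Y : Module.End ℂ Fock) :
    PowerSeries.X * traceLin (aMinus q * Y) = traceLin (Y * aMinus q) := by
  ext m
  cases m with
  | zero => simp [traceLin_apply, traceZ, aMinus_single_zero]
  | succ m =>
    rw [PowerSeries.coeff_succ_X_mul]
    simp [traceLin_apply, traceZ, aMinus_apply, aMinus_single_succ]

theorem traceLin_kBoson_mul (q : ℂ) (Y : Module.End ℂ Fock) :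
    traceLin (kBoson q * Y) = traceLin (Y * kBoson q) := by
  ext m
  simp [traceLin_apply, traceZ, kBoson_apply, kBoson_single]

/-- Cyclicity of the trace: `z^h` scales `K^β_α` by `z^{1-β-α}`. -/
theorem traceLin_locK_mul (q : ℂ) (Y : Module.End ℂ Fock) (d d' : Fin 2) :
    PowerSeries.X ^ ((d : ℕ) + (d' : ℕ)) * traceLin (locK q d d' * Y) =
      PowerSeries.X * traceLin (Y * locK q d d') := by
  revert d d'
  simp only [Fin.forall_fin_two, locK_zero_zero, locK_zero_one, locK_one_zero, locK_one_one,
    smul_mul_assoc, mul_smul_comm, map_smul, Fin.val_zero, Fin.val_one, traceLin_aPlus_mul,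
    traceLin_kBoson_mul, ← traceLin_aMinus_mul]
  refine ⟨⟨by simp, by simp⟩, by simp, by ring⟩

section
variable {q : ℂ} (hq : ∀ m : ℕ, 0 < m → q ^ m ≠ 1)
include hq

/-- The adjoint of `aMinus_eta_one`: the pairing makes a⁺ the transpose of a⁻, and passing z^h costs
a factor z. -/
theorem bdryLin_one_aPlus (k' : ℕ) (Y : Module.End ℂ Fock) :
    bdryLin q 1 k' (aPlus * Y) =
      PowerSeries.X * (bdryLin q 1 k' Y + PowerSeries.C q * bdryLin q 1 k' (kBoson q * Y)) := by
  ext m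
  simp only [bdryLin_eq, Module.End.mul_apply]
  cases m with
  | zero => simp [coeff_bdryVec, aPlus_apply]
  | succ m =>
    rw [PowerSeries.coeff_succ_X_mul]
    simp only [map_add, PowerSeries.coeff_C_mul, coeff_bdryVec, aPlus_apply, kBoson_apply,
      normSq_succ, if_neg (Nat.succ_ne_zero m), Nat.add_sub_cancel]
    linear_combination (1 + q ^ (m + 1)) * normSq q m * Y (eta q k') m * eta_one_succ hq m

theorem bdryLin_one_aMinus (k' : ℕ) (Y : Module.End ℂ Fock) :
    PowerSeries.X * bdryLin q 1 k' (aMinus q * Y) =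
      bdryLin q 1 k' Y - bdryLin q 1 k' (kBoson q * Y) := by
  ext m
  simp only [bdryLin_eq, Module.End.mul_apply]
  cases m with
  | zero =>
    rw [map_sub, coeff_bdryVec, coeff_bdryVec]
    simp [kBoson_apply]
  | succ m =>
    rw [PowerSeries.coeff_succ_X_mul]
    simp only [map_sub, coeff_bdryVec, aMinus_apply, kBoson_apply, normSq_succ]
    linear_combination -(1 - q ^ (2 * (m + 1))) * normSq q m * Y (eta q k') (m + 1) *
      eta_one_succ hq m

theorem bdryLin_two_aPlus (k' : ℕ) (Y : Module.End ℂ Fock) :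
    bdryLin q 2 k' (aPlus * Y) = PowerSeries.X ^ 2 * bdryLin q 2 k' (aMinus q * Y) := by
  ext m
  simp only [bdryLin_eq, Module.End.mul_apply]
  rw [PowerSeries.coeff_X_pow_mul']
  match m with
  | 0 => simp [coeff_bdryVec, aPlus_apply]
  | 1 => simp [coeff_bdryVec, aPlus_apply, eta_two_one]
  | m + 2 =>
    simp only [coeff_bdryVec, aMinus_apply, aPlus_apply, normSq_succ,
      if_neg (Nat.succ_ne_zero _), Nat.add_sub_cancel, le_add_iff_nonneg_left, zero_le, if_true,
      Nat.succ_sub_one]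
    linear_combination (1 - q ^ (2 * (m + 1))) * normSq q m * Y (eta q k') (m + 1) *
      eta_two_add_two hq m

end

/-! ## The `q`-difference equations of `⟨η_k| z^h |η_{k'}⟩` -/

theorem coeff_bdry_one (q : ℂ) (k k' m : ℕ) :
    PowerSeries.coeff m (bdry q k k' 1) = eta q k m * normSq q m * eta q k' m := by
  simp [bdry]

theorem constantCoeff_bdry_one (q : ℂ) (k k' : ℕ) :
    PowerSeries.constantCoeff (bdry q k k' 1) = 1 := by
  rw [← PowerSeries.coeff_zero_eq_constantCoeff_apply, coeff_bdry_one]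
  simp [eta_zero, qPoch]

theorem bdry_inv_mul_self (q : ℂ) (k k' : ℕ) : (bdry q k k' 1)⁻¹ * bdry q k k' 1 = 1 :=
  PowerSeries.inv_mul_cancel _ (by rw [constantCoeff_bdry_one]; exact one_ne_zero)

theorem polynomial_ne_zero_of_coeff_zero {d : Polynomial ℂ} (h : d.coeff 0 = 1) : d ≠ 0 := by
  rintro rfl
  simp at h

section
variable {q : ℂ} (hq : ∀ m : ℕ, 0 < m → q ^ m ≠ 1)
include hq

/-- The ratio of consecutive coefficients is (1 + q^{m+1})/(1 - q^{m+1}), which amounts to (1 + qz)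
F(qz) = (1 - z) F(z). -/
theorem rescale_bdry_one_one :
    RatMul (bdry q 1 1 1) (PowerSeries.rescale q (bdry q 1 1 1)) := by
  refine RatMul.of_mul_eq (p := 1 - Polynomial.X) (d := 1 + Polynomial.C q * Polynomial.X)
    (polynomial_ne_zero_of_coeff_zero (by simp)) ?_
  ext m
  simp only [Polynomial.coe_add, Polynomial.coe_sub, Polynomial.coe_one, Polynomial.coe_mul,
    Polynomial.coe_C, Polynomial.coe_X, mul_add, sub_mul, one_mul, mul_one, map_add, map_sub]
  rw [mul_left_comm, mul_comm _ PowerSeries.X]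
  cases m with
  | zero => simp
  | succ m =>
    rw [PowerSeries.coeff_C_mul, PowerSeries.coeff_succ_X_mul, PowerSeries.coeff_succ_X_mul]
    simp only [PowerSeries.coeff_rescale, coeff_bdry_one, normSq_succ]
    rw [← eta_one_succ hq m]
    ring

theorem rescale_bdry_one_two :
    RatMul (bdry q 1 2 1) (PowerSeries.rescale q (bdry q 1 2 1)) := by
  refine RatMul.of_mul_eq (p := 1 - Polynomial.X ^ 2) (d := 1 + Polynomial.C q * Polynomial.X ^ 2)
    (polynomial_ne_zero_of_coeff_zero (by simp)) ?_
  ext m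
  simp only [Polynomial.coe_add, Polynomial.coe_sub, Polynomial.coe_one, Polynomial.coe_mul,
    Polynomial.coe_C, Polynomial.coe_X, Polynomial.coe_pow, mul_add, sub_mul, one_mul, mul_one,
    map_add, map_sub]
  rw [mul_left_comm, mul_comm _ (PowerSeries.X ^ 2), PowerSeries.coeff_C_mul,
    PowerSeries.coeff_X_pow_mul', PowerSeries.coeff_X_pow_mul']
  match m with
  | 0 => simp
  | 1 => simp [coeff_bdry_one, eta_two_one]
  | m + 2 =>
    simp only [PowerSeries.coeff_rescale, coeff_bdry_one, normSq_succ, le_add_iff_nonneg_left,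
      zero_le, if_true, Nat.add_sub_cancel]
    rw [← eta_one_succ hq m, ← eta_one_succ hq (m + 1), ← eta_two_add_two hq m]
    ring

omit hq in
theorem bdry_one_comm (k k' : ℕ) : bdry q k k' 1 = bdry q k' k 1 := by
  ext m
  rw [coeff_bdry_one, coeff_bdry_one]
  ring

/-- The ratio of the coefficients at m + 2 and m is (1 - q^{2(m+1)})/(1 - q^{2(m+2)}). It depends on
q^{2m} only, so the equation has step q² and gives no relation of F(qz) to F(z). -/
theorem rescale_bdry_two_two_eq :
    PowerSeries.rescale (q ^ 2) (bdry q 2 2 1) *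
        (1 - PowerSeries.C (q ^ 2) * PowerSeries.X ^ 2) =
      (1 - PowerSeries.X ^ 2) * bdry q 2 2 1 := by
  ext m
  simp only [mul_sub, sub_mul, one_mul, mul_one, map_sub]
  rw [mul_left_comm, mul_comm _ (PowerSeries.X ^ 2), PowerSeries.coeff_C_mul,
    PowerSeries.coeff_X_pow_mul', PowerSeries.coeff_X_pow_mul']
  match m with
  | 0 => simp
  | 1 => simp [coeff_bdry_one, eta_two_one]
  | m + 2 =>
    simp only [PowerSeries.coeff_rescale, coeff_bdry_one, normSq_succ, le_add_iff_nonneg_left,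
      zero_le, if_true, Nat.add_sub_cancel]
    rw [← eta_two_add_two hq m]
    ring

theorem rescale_bdry_two_two :
    RatMul (bdry q 2 2 1) (PowerSeries.rescale (q ^ 2) (bdry q 2 2 1)) :=
  RatMul.of_mul_eq (p := 1 - Polynomial.X ^ 2)
    (d := 1 - Polynomial.C (q ^ 2) * Polynomial.X ^ 2)
    (polynomial_ne_zero_of_coeff_zero (by simp))
    (by simpa using rescale_bdry_two_two_eq hq)

/-- `⟨η_2| z^h |η_2⟩` at `z` times its value at `q z` is `1 / (1 - z²)`. -/
theorem bdry_two_two_mul_rescale :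
    RatMul 1 (bdry q 2 2 1 * PowerSeries.rescale q (bdry q 2 2 1)) := by
  set F := bdry q 2 2 1 with hF
  set T := F * PowerSeries.rescale q F * (1 - PowerSeries.X ^ 2) with hT
  -- The q²-equation makes T = F(z) F(qz) (1 - z²) invariant under z ↦ qz. As q is not a root of
  -- unity, T is then its constant term 1.
  have h1 : PowerSeries.rescale q T = T := by
    have h2 := rescale_bdry_two_two_eq hq
    rw [← hF, sq q, PowerSeries.rescale_mul, RingHom.comp_apply] at h2
    rw [hT, map_mul, map_mul, map_sub, map_pow, map_one, PowerSeries.rescale_X, mul_pow, ← map_pow,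
      sq q]
    linear_combination PowerSeries.rescale q F * h2
  have h2 : T = 1 := by
    ext m
    rcases Nat.eq_zero_or_pos m with rfl | hm
    · have h3 : PowerSeries.constantCoeff (PowerSeries.rescale q F) = 1 := by
        rw [← PowerSeries.coeff_zero_eq_constantCoeff_apply, PowerSeries.coeff_rescale, pow_zero,
          one_mul, PowerSeries.coeff_zero_eq_constantCoeff_apply, constantCoeff_bdry_one]
      have h4 : PowerSeries.constantCoeff F = 1 := constantCoeff_bdry_one q 2 2
      simp [hT, h3, h4]
    · have h3 := congrArg (PowerSeries.coeff m) h1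
      rw [PowerSeries.coeff_rescale] at h3
      have h4 : (q ^ m - 1) * PowerSeries.coeff m T = 0 := by linear_combination h3
      rw [PowerSeries.coeff_one, if_neg hm.ne']
      exact (mul_eq_zero.mp h4).resolve_left (sub_ne_zero.mpr (hq m hm))
  refine RatMul.of_mul_eq (p := 1) (d := 1 - Polynomial.X ^ 2)
    (polynomial_ne_zero_of_coeff_zero (by simp)) ?_
  simpa [hT] using h2

end

/-! ## The entries of the `K` matrices are rational -/

theorem prodK_induction (q : ℂ) {motive : ℕ → Module.End ℂ Fock → Prop} (one : motive 0 1)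
    (mul : ∀ n b a X, motive n X → motive (n + 1) (locK q b a * X)) {n : ℕ} (β α : Conf n) :
    motive n (prodK q β α) := by
  induction n with
  | zero => simpa [prodK] using one
  | succ n ih =>
    rw [prodK, List.ofFn_succ, List.prod_cons]
    exact mul n _ _ _ (ih (fun i => β i.succ) fun i => α i.succ)

/-- Monomials in the `q`-bosons map `|m⟩` to `P(q^m) |m + s⟩`. -/
theorem prodK_single {q : ℂ} (hq : q ≠ 0) {n : ℕ} (β α : Conf n) :
    ∃ (s : ℤ) (P : Polynomial ℂ), ∀ m : ℕ, ((m : ℤ) + s < 0 → P.eval (q ^ m) = 0) ∧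
      ∀ l : ℕ, prodK q β α (Pi.single m 1) l = if (l : ℤ) = m + s then P.eval (q ^ m) else 0 := by
  -- The vanishing clause for m + s < 0 records that the vector has been annihilated. Without it, a
  -- later a⁺ raising s would make the formula predict a nonzero component.
  refine prodK_induction q (motive := fun _ X => ∃ (s : ℤ) (P : Polynomial ℂ), ∀ m : ℕ,
    ((m : ℤ) + s < 0 → P.eval (q ^ m) = 0) ∧
      ∀ l : ℕ, X (Pi.single m 1) l = if (l : ℤ) = m + s then P.eval (q ^ m) else 0) ?_ ?_ β α
  · refine ⟨0, 1, fun m => ⟨fun h => by omega, fun l => ?_⟩⟩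
    simp [Pi.single_apply]
  · rintro - b a X ⟨s, P, h⟩
    have hk : ∀ c : ℂ, ∃ P' : Polynomial ℂ, ∀ m : ℕ, ((m : ℤ) + s < 0 → P'.eval (q ^ m) = 0) ∧
        ∀ l : ℕ, (c • (kBoson q * X)) (Pi.single m 1) l =
          if (l : ℤ) = m + s then P'.eval (q ^ m) else 0 := by
      intro c
      refine ⟨Polynomial.C (c * q ^ s) * Polynomial.X * P, fun m => ⟨fun hm => ?_, fun l => ?_⟩⟩
      · simp [(h m).1 hm]
      · simp only [LinearMap.smul_apply, Module.End.mul_apply, Pi.smul_apply, smul_eq_mul,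
          kBoson_apply, (h m).2 l]
        split_ifs with hl
        · have : q ^ l = q ^ s * q ^ m := by
            rw [← zpow_natCast, hl, zpow_add₀ hq, zpow_natCast, mul_comm]
          simp only [this, Polynomial.eval_mul, Polynomial.eval_C, Polynomial.eval_X]
          ring
        · simp
    match b, a with
    | 0, 0 =>
      refine ⟨s + 1, P, fun m => ⟨fun hm => (h m).1 (by omega), fun l => ?_⟩⟩
      simp only [locK_zero_zero, Module.End.mul_apply, aPlus_apply]
      cases l with
      | zero =>
        rw [if_pos rfl]
        split_ifs with hl
        · exact ((h m).1 (by simp at hl; omega)).symm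
        · rfl
      | succ l =>
        rw [if_neg (Nat.succ_ne_zero l), Nat.add_sub_cancel, (h m).2 l]
        congr 1
        simp only [Nat.cast_add, Nat.cast_one, eq_iff_iff]
        omega
    | 0, 1 =>
      obtain ⟨P', h'⟩ := hk (-q)
      exact ⟨s, P', by simpa only [locK_zero_one, smul_mul_assoc] using h'⟩
    | 1, 0 =>
      obtain ⟨P', h'⟩ := hk 1
      exact ⟨s, P', by simpa only [locK_one_zero, one_smul] using h'⟩
    | 1, 1 =>
      refine ⟨s - 1, (1 - Polynomial.C (q ^ s * q ^ s) * Polynomial.X ^ 2) * P,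
        fun m => ⟨fun hm => ?_, fun l => ?_⟩⟩
      · rcases lt_or_eq_of_le (show (m : ℤ) + s ≤ 0 by omega) with h0 | h0
        · simp [(h m).1 h0]
        -- The new boundary case m + s = 0, where a⁻ kills |0⟩: the factor 1 - q^{2(m+s)} vanishes.
        · have : q ^ s * q ^ m = 1 := by
            rw [← zpow_natCast, ← zpow_add₀ hq, add_comm, h0, zpow_zero]
          simp only [Polynomial.eval_mul, Polynomial.eval_sub, Polynomial.eval_one,
            Polynomial.eval_C, Polynomial.eval_pow, Polynomial.eval_X]
          linear_combination -(1 + q ^ s * q ^ m) * P.eval (q ^ m) * this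
      · simp only [locK_one_one, Module.End.mul_apply, aMinus_apply, (h m).2 (l + 1)]
        have hiff : ((l + 1 : ℕ) : ℤ) = m + s ↔ (l : ℤ) = m + (s - 1) := by push_cast; omega
        simp only [hiff]
        split_ifs with hl
        · have : q ^ (l + 1) = q ^ s * q ^ m := by
            rw [← zpow_natCast, hiff.mpr hl, zpow_add₀ hq, zpow_natCast, mul_comm]
          rw [mul_comm 2, pow_mul, this]
          simp only [Polynomial.eval_mul, Polynomial.eval_sub, Polynomial.eval_one,
            Polynomial.eval_C, Polynomial.eval_pow, Polynomial.eval_X]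
          ring
        · simp

/-- Diagonal entries exist only for total shift s = 0, and then the trace is ∑ P(q^m) z^m, a
combination of the fractions 1/(1 - q^j z). -/
theorem ratMul_traceZ {q : ℂ} (hq : q ≠ 0) {n : ℕ} (β α : Conf n) :
    RatMul 1 (traceZ (prodK q β α)) := by
  obtain ⟨s, P, h⟩ := prodK_single hq β α
  have hone : (PowerSeries.mk 1 : ℂ⟦X⟧) * (1 - PowerSeries.X) = 1 :=
    PowerSeries.mk_one_mul_one_sub_eq_one ℂ
  have h1 : RatMul 1 (PowerSeries.mk 1 : ℂ⟦X⟧) :=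
    RatMul.of_mul_eq (p := 1) (d := 1 - Polynomial.X)
      (polynomial_ne_zero_of_coeff_zero (by simp)) (by simpa using hone)
  have h2 : RatMul (PowerSeries.mk 1 : ℂ⟦X⟧) (PowerSeries.rescale q 1) := by
    rw [map_one]
    refine ⟨1 - Polynomial.X, 1, one_ne_zero, ?_⟩
    simpa [mul_comm] using hone.symm
  have h3 := h2.trans (h1.rescale hq)
  by_cases hs : s = 0
  · convert h1.trans (RatMul.weighted hq h3 (RatMul.refl _) P) using 1
    ext m
    simp [traceZ, (h m).2, hs]
  · convert RatMul.zero 1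
    ext m
    simp [traceZ, (h m).2, hs]

theorem ratMul_KTrSeries {q : ℂ} (hq : q ≠ 0) {n : ℕ} (β α : Conf n) :
    RatMul 1 (KTrSeries q β α) := by
  have := (ratMul_traceZ hq β α).poly_mul
    (Polynomial.C ((-1) ^ wt α * q ^ min (0 : ℤ) (2 * (wt α : ℤ) - n)) *
      (1 - Polynomial.C (q ^ |(n : ℤ) - 2 * (wt α : ℤ)|) * Polynomial.X))
  simpa [KTrSeries] using this

section
variable {q : ℂ} (hq0 : q ≠ 0) (hq : ∀ m : ℕ, 0 < m → q ^ m ≠ 1)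
include hq0 hq

/-- Vectors of the form P(q^h)|η_1⟩ are stable under a⁺, a⁻ and k, because the recursion turns a
shift of η_1 into multiplication by a polynomial in q^m. -/
theorem prodK_eta_one {n : ℕ} (β α : Conf n) :
    ∃ P : Polynomial ℂ, ∀ m, prodK q β α (eta q 1) m = P.eval (q ^ m) * eta q 1 m := by
  refine prodK_induction q (motive := fun _ X => ∃ P : Polynomial ℂ, ∀ m,
    X (eta q 1) m = P.eval (q ^ m) * eta q 1 m) ⟨1, by simp⟩ ?_ β α
  rintro - b a X ⟨P, h⟩
  have hk : ∀ c : ℂ, ∃ P : Polynomial ℂ, ∀ m,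
      (c • (kBoson q * X)) (eta q 1) m = P.eval (q ^ m) * eta q 1 m := by
    intro c
    refine ⟨Polynomial.C c * Polynomial.X * P, fun m => ?_⟩
    simp [kBoson_apply, h, mul_assoc]
  match b, a with
  | 0, 0 =>
    -- The factor 1 - X vanishes at q⁰ = 1, which gives the zero component of a⁺ at m = 0.
    refine ⟨P.comp (Polynomial.C q⁻¹ * Polynomial.X) * (1 - Polynomial.X), fun m => ?_⟩
    cases m with
    | zero => simp [aPlus_apply]
    | succ m =>
      have h1 : q⁻¹ * q ^ (m + 1) = q ^ m := by
        rw [pow_succ']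
        field_simp
      simp [aPlus_apply, h, h1]
      linear_combination -P.eval (q ^ m) * eta_one_succ hq m
  | 0, 1 => simpa only [locK_zero_one, smul_mul_assoc] using hk (-q)
  | 1, 0 => simpa only [locK_one_zero, one_smul] using hk 1
  | 1, 1 =>
    refine ⟨P.comp (Polynomial.C q * Polynomial.X) * (1 + Polynomial.C q * Polynomial.X),
      fun m => ?_⟩
    simp [aMinus_apply, h, ← pow_succ']
    linear_combination P.eval (q ^ (m + 1)) * (1 + q ^ (m + 1)) * eta_one_succ hq m

/-- Here d counts the factors k and c the factors a⁺, a⁻. Each k gives q^m. Since a⁻η_2 = a⁺η_2, the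
others alternate between η_2 and a⁺η_2, with coefficients polynomial in q^{2m}. The constraint d + c
= n carries the parity of n. -/
theorem prodK_eta_two {n : ℕ} (β α : Conf n) :
    ∃ (d c : ℕ) (P : Polynomial ℂ), d + c = n ∧ ∀ m, prodK q β α (eta q 2) m =
      q ^ (d * m) * P.eval ((q ^ 2) ^ m) * if Even c then eta q 2 m else aPlus (eta q 2) m := by
  refine prodK_induction q (motive := fun n X => ∃ (d c : ℕ) (P : Polynomial ℂ), d + c = n ∧
    ∀ m, X (eta q 2) m = q ^ (d * m) * P.eval ((q ^ 2) ^ m) *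
      if Even c then eta q 2 m else aPlus (eta q 2) m) ⟨0, 0, 1, rfl, by simp⟩ ?_ β α
  rintro n b a X ⟨d, c, P, hdc, h⟩
  have hk : ∀ x : ℂ, ∃ (d c : ℕ) (P : Polynomial ℂ), d + c = n + 1 ∧
      ∀ m, (x • (kBoson q * X)) (eta q 2) m = q ^ (d * m) * P.eval ((q ^ 2) ^ m) *
        if Even c then eta q 2 m else aPlus (eta q 2) m := by
    intro x
    refine ⟨d + 1, c, Polynomial.C x * P, by omega, fun m => ?_⟩
    simp only [LinearMap.smul_apply, Module.End.mul_apply, Pi.smul_apply, smul_eq_mul,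
      kBoson_apply, h, Polynomial.eval_mul, Polynomial.eval_C]
    ring
  have hz : ∀ m, aPlus (eta q 2) (m + 1) = eta q 2 m := fun m => by simp [aPlus_apply]
  have hz' : ∀ m, aPlus (eta q 2) m = (1 - q ^ (2 * (m + 1))) * eta q 2 (m + 1) := fun m => by
    rw [← aMinus_eta_two hq, aMinus_apply]
  match b, a with
  | 0, 0 =>
    by_cases hc : Even c
    · refine ⟨d, c + 1, Polynomial.C (q⁻¹ ^ d) * P.comp (Polynomial.C (q ^ 2)⁻¹ * Polynomial.X),
        by omega, fun m => ?_⟩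
      rw [if_neg (by simpa [Nat.even_add_one] using hc)]
      simp only [locK_zero_zero, Module.End.mul_apply]
      cases m with
      | zero => simp [aPlus_apply]
      | succ m =>
        have h1 : (q ^ 2)⁻¹ * (q ^ 2) ^ (m + 1) = (q ^ 2) ^ m := by
          rw [pow_succ' (q ^ 2)]
          field_simp
        have h2 : q⁻¹ ^ d * q ^ (d * (m + 1)) = q ^ (d * m) := by
          rw [mul_add, pow_add, mul_one, inv_pow]
          field_simp
        rw [hz, aPlus_apply, if_neg (Nat.succ_ne_zero m), Nat.add_sub_cancel, h, if_pos hc]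
        simp only [Polynomial.eval_mul, Polynomial.eval_C, Polynomial.eval_comp,
          Polynomial.eval_X, h1]
        linear_combination -P.eval ((q ^ 2) ^ m) * eta q 2 m * h2
    · refine ⟨d, c + 1, Polynomial.C (q⁻¹ ^ d) * P.comp (Polynomial.C (q ^ 2)⁻¹ * Polynomial.X) *
        (1 - Polynomial.X), by omega, fun m => ?_⟩
      rw [if_pos (by simpa [Nat.even_add_one] using hc)]
      simp only [locK_zero_zero, Module.End.mul_apply]
      cases m with
      | zero => simp [aPlus_apply]
      | succ m =>
        have h1 : (q ^ 2)⁻¹ * (q ^ 2) ^ (m + 1) = (q ^ 2) ^ m := by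
          rw [pow_succ' (q ^ 2)]
          field_simp
        have h2 : q⁻¹ ^ d * q ^ (d * (m + 1)) = q ^ (d * m) := by
          rw [mul_add, pow_add, mul_one, inv_pow]
          field_simp
        rw [aPlus_apply, if_neg (Nat.succ_ne_zero m), Nat.add_sub_cancel, h, if_neg hc, hz']
        simp only [Polynomial.eval_mul, Polynomial.eval_C, Polynomial.eval_comp,
          Polynomial.eval_X, Polynomial.eval_sub, Polynomial.eval_one, h1]
        rw [← pow_mul q 2 (m + 1)]
        linear_combination -P.eval ((q ^ 2) ^ m) * (1 - q ^ (2 * (m + 1))) * eta q 2 (m + 1) * h2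
  | 0, 1 => simpa only [locK_zero_one, smul_mul_assoc] using hk (-q)
  | 1, 0 => simpa only [locK_one_zero, one_smul] using hk 1
  | 1, 1 =>
    have h1 : ∀ m, q ^ 2 * (q ^ 2) ^ m = (q ^ 2) ^ (m + 1) := fun m => (pow_succ' _ _).symm
    by_cases hc : Even c
    · refine ⟨d, c + 1, Polynomial.C (q ^ d) * P.comp (Polynomial.C (q ^ 2) * Polynomial.X),
        by omega, fun m => ?_⟩
      rw [if_neg (by simpa [Nat.even_add_one] using hc)]
      simp only [h, if_pos hc, locK_one_one, Module.End.mul_apply, aMinus_apply, hz',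
        Polynomial.eval_mul, Polynomial.eval_C, Polynomial.eval_comp, Polynomial.eval_X, h1]
      ring
    · refine ⟨d, c + 1, Polynomial.C (q ^ d) * P.comp (Polynomial.C (q ^ 2) * Polynomial.X) *
        (1 - Polynomial.C (q ^ 2) * Polynomial.X), by omega, fun m => ?_⟩
      rw [if_pos (by simpa [Nat.even_add_one] using hc)]
      simp only [h, if_neg hc, locK_one_one, Module.End.mul_apply, aMinus_apply, hz,
        Polynomial.eval_mul, Polynomial.eval_C, Polynomial.eval_comp, Polynomial.eval_X,
        Polynomial.eval_sub, Polynomial.eval_one, h1]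
      ring

omit hq0 hq in
theorem bdry_eq_mk (k k' : ℕ) (X : Module.End ℂ Fock) :
    bdry q k k' X = PowerSeries.mk fun m => eta q k m * normSq q m * X (eta q k') m := rfl

theorem ratMul_bdry_right_one {k : ℕ}
    (hF : RatMul (bdry q k 1 1) (PowerSeries.rescale q (bdry q k 1 1))) {n : ℕ} (β α : Conf n) :
    RatMul (bdry q k 1 1) (bdry q k 1 (prodK q β α)) := by
  obtain ⟨P, h⟩ := prodK_eta_one hq0 hq β α
  convert RatMul.weighted hq0 hF (RatMul.refl _) P using 1
  ext m
  simp only [bdry_eq_mk, PowerSeries.coeff_mk, h, Module.End.one_apply]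
  ring

theorem ratMul_bdry_one_two {n : ℕ} (β α : Conf n) :
    RatMul (bdry q 1 2 1) (bdry q 1 2 (prodK q β α)) := by
  have hF := rescale_bdry_one_two hq
  obtain ⟨d, c, P, -, h⟩ := prodK_eta_two hq0 hq β α
  have h1 : ∀ m, q ^ (d * m) * P.eval ((q ^ 2) ^ m) =
      (Polynomial.X ^ d * P.comp (Polynomial.X ^ 2)).eval (q ^ m) := by
    intro m
    simp [← pow_mul, mul_comm]
  by_cases hc : Even c
  · convert RatMul.weighted hq0 hF (RatMul.refl _) (Polynomial.X ^ d * P.comp (Polynomial.X ^ 2))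
      using 1
    ext m
    rw [PowerSeries.coeff_mk, ← h1, bdry_eq_mk, PowerSeries.coeff_mk, h, if_pos hc, coeff_bdry_one]
    ring
  -- For odd c the base series is ⟨η_1|z^h a⁺|η_2⟩ = z (F(z) + q F(qz)), by the boundary relation
  -- with Y = 1.
  · have hG : RatMul (bdry q 1 2 1) (bdry q 1 2 aPlus) := by
      have h2 := bdryLin_one_aPlus hq 2 1
      have h3 : bdryLin q 1 2 (kBoson q * 1) = PowerSeries.rescale q (bdry q 1 2 1) := by
        ext m
        rw [PowerSeries.coeff_rescale, coeff_bdry_one, bdryLin_apply, bdry_eq_mk,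
          PowerSeries.coeff_mk, mul_one, kBoson_apply]
        ring
      rw [h3, mul_one, bdryLin_apply, bdryLin_apply] at h2
      rw [h2]
      exact ((RatMul.refl _).add (hF.C_mul q)).X_mul
    convert RatMul.weighted hq0 hF hG (Polynomial.X ^ d * P.comp (Polynomial.X ^ 2)) using 1
    ext m
    rw [PowerSeries.coeff_mk, ← h1, bdry_eq_mk, PowerSeries.coeff_mk, h, if_neg hc, bdry_eq_mk,
      PowerSeries.coeff_mk]
    ring

/-- For odd c the entry is zero, as η_2 and a⁺η_2 have disjoint supports. For even c the exponent d
has the parity of n. An odd d leaves one factor q^m outside the polynomial in q^{2m}, which replaces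
F(z) by F(qz). -/
theorem ratMul_bdry_two_two {n : ℕ} (β α : Conf n) :
    RatMul (if Odd n then PowerSeries.rescale q (bdry q 2 2 1) else bdry q 2 2 1)
      (bdry q 2 2 (prodK q β α)) := by
  have hF := rescale_bdry_two_two hq
  have hq2 : q ^ 2 ≠ 0 := pow_ne_zero 2 hq0
  obtain ⟨d, c, P, hdc, h⟩ := prodK_eta_two hq0 hq β α
  by_cases hc : Even c
  · split_ifs with hn
    · obtain ⟨e, rfl⟩ : Odd d := by
        rw [← hdc] at hn
        exact (Nat.odd_add.mp hn).mpr hc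
      have hG := hF.rescale hq0
      rw [PowerSeries.rescale_rescale, mul_comm, ← PowerSeries.rescale_rescale] at hG
      convert RatMul.weighted hq2 hG (RatMul.refl _) (Polynomial.X ^ e * P) using 1
      ext m
      rw [PowerSeries.coeff_mk, bdry_eq_mk, PowerSeries.coeff_mk, h, if_pos hc,
        PowerSeries.coeff_rescale, coeff_bdry_one, Polynomial.eval_mul, Polynomial.eval_pow,
        Polynomial.eval_X, ← pow_mul q, ← pow_mul q]
      have : q ^ ((2 * e + 1) * m) = q ^ (2 * m * e) * q ^ m := by
        rw [← pow_add]
        ring_nf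
      rw [this]
      ring
    · obtain ⟨e, rfl⟩ : Even d := by
        rw [← hdc, Nat.not_odd_iff_even] at hn
        exact (Nat.even_add.mp hn).mpr hc
      convert RatMul.weighted hq2 hF (RatMul.refl _) (Polynomial.X ^ e * P) using 1
      ext m
      rw [PowerSeries.coeff_mk, bdry_eq_mk, PowerSeries.coeff_mk, h, if_pos hc,
        coeff_bdry_one, Polynomial.eval_mul, Polynomial.eval_pow,
        Polynomial.eval_X, ← pow_mul q, ← pow_mul q]
      have : q ^ ((e + e) * m) = q ^ (2 * m * e) := by
        ring_nf
      rw [this]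
      ring
  · convert RatMul.zero _
    ext m
    rw [bdry_eq_mk, PowerSeries.coeff_mk, h, if_neg hc, map_zero]
    cases m with
    | zero => simp [aPlus_apply]
    | succ m =>
      have h1 : aPlus (eta q 2) (m + 1) = eta q 2 m := by simp [aPlus_apply]
      rw [h1]
      linear_combination normSq q (m + 1) * q ^ (d * (m + 1)) *
        P.eval ((q ^ 2) ^ (m + 1)) * eta_two_mul_succ m

/-- Dividing by F works whenever the entry is a rational multiple of F. For k = k' = 2 and n odd it
is a multiple of F(qz), and multiplying by F(z) is what gives a rational function. -/
theorem ratMul_KSeries {k k' : ℕ} (hk : k = 1 ∨ k = 2) (hk' : k' = 1 ∨ k' = 2) {n : ℕ}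
    (β α : Conf n) : RatMul 1 (KSeries q k k' β α) := by
  have key : ∀ {k k' : ℕ}, RatMul (bdry q k k' 1) (bdry q k k' (prodK q β α)) →
      RatMul 1 ((bdry q k k' 1)⁻¹ * bdry q k k' (prodK q β α)) := by
    intro k k' h
    have := h.mul_left (bdry q k k' 1)⁻¹
    rwa [bdry_inv_mul_self] at this
  rcases hk with rfl | rfl <;> rcases hk' with rfl | rfl
  · simpa [KSeries] using key (ratMul_bdry_right_one hq0 hq (rescale_bdry_one_one hq) β α)
  · simpa [KSeries] using key (ratMul_bdry_one_two hq0 hq β α)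
  · have h := rescale_bdry_one_two hq
    rw [bdry_one_comm] at h
    simpa [KSeries] using key (ratMul_bdry_right_one hq0 hq h β α)
  · have h := ratMul_bdry_two_two hq0 hq β α
    by_cases hn : Odd n
    · rw [if_pos hn] at h
      simpa [KSeries, hn] using (bdry_two_two_mul_rescale hq).trans (h.mul_left _)
    · rw [if_neg hn] at h
      simpa [KSeries, hn] using key h

end

/-! ## Intertwining of the matrix products with the generators -/

section
variable {n : ℕ} {R : Type*} [CommRing R] [Algebra ℂ R]

theorem smul_bondOp (p : ℂ) (v : Fin n → ℤ) (u w x c : R) :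
    c • bondOp p v u w x = bondOp p v (c * u) (c * w) (c * x) := by
  ext β α
  simp only [bondOp, Matrix.smul_apply, Matrix.of_apply, smul_eq_mul]
  ring

theorem bondLoc_algebraMap (p : ℂ) (a b : ℤ) (u w x : ℂ) (c d c' d' : Fin 2) :
    bondLoc p a b (algebraMap ℂ R u) (algebraMap ℂ R w) (algebraMap ℂ R x) c d c' d' =
      algebraMap ℂ R (bondLoc p a b u w x c d c' d') := by
  simp only [bondLoc, map_add, apply_ite (algebraMap ℂ R), map_zero, map_mul,
    Algebra.algebraMap_self, RingHom.id_apply]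

theorem wt_eq_of_shiftOp_ne_zero {v : Fin n → ℤ} {β α : Conf n} (h : shiftOp v β α ≠ 0) :
    (wt β : ℤ) = wt α + ∑ i, v i := by
  simp only [shiftOp, Matrix.of_apply, ne_eq, ite_eq_right_iff, one_ne_zero, imp_false,
    not_not] at h
  simp only [wt, Nat.cast_sum, h, Finset.sum_add_distrib]

theorem sum_bond (i j : Fin n) (a b : ℤ) : ∑ l, bond i j a b l = a + b := by
  simpa using sum_bond_mul i j a b 1

theorem sum_bond_sq {i j : Fin n} (hij : i ≠ j) (a b : ℤ) :
    ∑ l, bond i j a b l ^ 2 = a ^ 2 + b ^ 2 := by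
  simp only [sq, sum_bond_mul]
  simp [bond, hij, hij.symm]

/-- Functions of the weight commute with the generators of weight zero. -/
theorem diagonal_wt_mul_bondOp (p : ℂ) {v : Fin n → ℤ} (hv : ∑ i, v i = 0) (u w x : R)
    (f : ℕ → R) :
    Matrix.diagonal (fun α : Conf n => f (wt α)) * bondOp p v u w x =
      bondOp p v u w x * Matrix.diagonal fun α => f (wt α) := by
  ext β α
  rw [Matrix.diagonal_mul, Matrix.mul_diagonal, mul_comm]
  by_cases h : wt β = wt α
  · rw [h]
  · have h1 : shiftOp v β α = 0 := by
      by_contra h'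
      exact h (by have := wt_eq_of_shiftOp_ne_zero h'; omega)
    have h2 : shiftOp (-v) β α = 0 := by
      by_contra h'
      refine h ?_
      have := wt_eq_of_shiftOp_ne_zero h'
      simp only [Pi.neg_apply, Finset.sum_neg_distrib] at this
      omega
    have h3 : kInvOp p v β α = 0 := by
      rw [kInvOp, Matrix.diagonal_apply_ne]
      rintro rfl
      exact h rfl
    simp [bondOp, h1, h2, h3]

end

/-- The matrix of the values of a linear functional on the matrix products. -/
def prodMat (q : ℂ) (n : ℕ) (F : Module.End ℂ Fock →ₗ[ℂ] ℂ⟦X⟧) :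
    Matrix (Conf n) (Conf n) ℂ⟦X⟧ :=
  Matrix.of fun β α => F (prodK q β α)

section
variable {p q d : ℂ} {n : ℕ}

theorem algebraMap_eq_C (c : ℂ) : algebraMap ℂ ℂ⟦X⟧ c = PowerSeries.C c := rfl

theorem mul_algebraMap_eq_smul (f : ℂ⟦X⟧) (c : ℂ) : f * algebraMap ℂ ℂ⟦X⟧ c = c • f := by
  rw [mul_comm, Algebra.smul_def]

theorem algebraMap_mul_eq_smul (f : ℂ⟦X⟧) (c : ℂ) : algebraMap ℂ ℂ⟦X⟧ c * f = c • f := by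
  rw [Algebra.smul_def]

theorem prodMat_bulk (h : Params p q d) (F : Module.End ℂ Fock →ₗ[ℂ] ℂ⟦X⟧) {i j : Fin n}
    (hij : (i : ℕ) + 1 = j) :
    prodMat q n F * bondOp p (bond i j (-1) 1) 1 1 (PowerSeries.C d) =
      bondOp p (bond i j (-1) 1) 1 1 (PowerSeries.C d) * prodMat q n F := by
  have hne : i ≠ j := fun h => by rw [h] at hij; omega
  refine bondOp_intertwine p hne _ _ _ _ _ _ _ _ _ fun β α => ?_
  obtain ⟨A, B, -, -, hAB⟩ := prodK_upd q i j hij β α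
  have hβ := fun c d => hAB (β i) (β j) c d
  have hα := fun c d => hAB c d (α i) (α j)
  simp only [upd_self] at hβ hα
  have h1 := fun a b => bondLoc_algebraMap (R := ℂ⟦X⟧) p (-1) 1 1 1 d a b
  simp only [map_one, algebraMap_eq_C] at h1
  have key := congrArg (fun M => F (A * M * B)) (locK_bulk h (β i) (β j) (α i) (α j))
  simp only [Finset.mul_sum, Finset.sum_mul, map_sum, mul_smul_comm, smul_mul_assoc,
    map_smul] at key
  simp only [prodMat, Matrix.of_apply, hβ, hα, h1]
  simpa only [← algebraMap_eq_C, mul_algebraMap_eq_smul, algebraMap_mul_eq_smul, mul_assoc] using key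

theorem prodMat_right {k k' : ℕ} {i j : Fin n} (hij : (i : ℕ) + 1 = j) (hj : (j : ℕ) + 1 = n)
    {a b : ℤ} {u w : ℂ}
    (h : ∀ c e c' e', ∑ x, ∑ y, bondLoc p a b u w d x y c' e' •
        (locK q c x * locK q e y) (eta q k') =
      ∑ x, ∑ y, bondLoc p a b u w d c e x y • (locK q x c' * locK q y e') (eta q k')) :
    prodMat q n (bdryLin q k k') * bondOp p (bond i j a b) (PowerSeries.C u) (PowerSeries.C w)
        (PowerSeries.C d) =
      bondOp p (bond i j a b) (PowerSeries.C u) (PowerSeries.C w) (PowerSeries.C d) *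
        prodMat q n (bdryLin q k k') := by
  have hne : i ≠ j := fun h => by rw [h] at hij; omega
  refine bondOp_intertwine p hne _ _ _ _ _ _ _ _ _ fun β α => ?_
  obtain ⟨A, B, -, hB, hAB⟩ := prodK_upd q i j hij β α
  have hβ := fun c d => hAB (β i) (β j) c d
  have hα := fun c d => hAB c d (α i) (α j)
  simp only [upd_self, hB hj, mul_one] at hβ hα
  have h1 := fun x y => bondLoc_algebraMap (R := ℂ⟦X⟧) p a b u w d x y
  simp only [algebraMap_eq_C] at h1
  have key := congrArg (fun v => bdryVec q k (A v)) (h (β i) (β j) (α i) (α j))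
  simp only [map_sum, map_smul] at key
  simp only [prodMat, Matrix.of_apply, hβ, hα, h1]
  simpa only [← algebraMap_eq_C, mul_algebraMap_eq_smul, algebraMap_mul_eq_smul, mul_assoc,
    bdryLin_eq, Module.End.mul_apply] using key

theorem prodMat_left {F : Module.End ℂ Fock →ₗ[ℂ] ℂ⟦X⟧} {i j : Fin n} (hij : (i : ℕ) + 1 = j)
    (hi : (i : ℕ) = 0) {a b : ℤ} {u w x u' w' x' : ℂ⟦X⟧}
    (h : ∀ Y c e c' e', ∑ y, ∑ z, F (locK q c y * locK q e z * Y) *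
        bondLoc p a b u w x y z c' e' =
      ∑ y, ∑ z, bondLoc p a b u' w' x' c e y z * F (locK q y c' * locK q z e' * Y)) :
    prodMat q n F * bondOp p (bond i j a b) u w x =
      bondOp p (bond i j a b) u' w' x' * prodMat q n F := by
  have hne : i ≠ j := fun h => by rw [h] at hij; omega
  refine bondOp_intertwine p hne _ _ _ _ _ _ _ _ _ fun β α => ?_
  obtain ⟨A, B, hA, -, hAB⟩ := prodK_upd q i j hij β α
  have hβ := fun c d => hAB (β i) (β j) c d
  have hα := fun c d => hAB c d (α i) (α j)
  simp only [upd_self, hA hi, one_mul] at hβ hα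
  simpa only [prodMat, Matrix.of_apply, hβ, hα] using h B (β i) (β j) (α i) (α j)

/-- On the closing bond the spectral parameter of z b_0(z) amounts to conjugation by z to the power
of the first spin, up to an overall z. These powers match those produced by cyclicity. -/
theorem X_pow_mul_bondLoc_col (c e c' e' : Fin 2) :
    (PowerSeries.X : ℂ⟦X⟧) ^ (e' : ℕ) *
        bondLoc p (-1) 1 1 (PowerSeries.X ^ 2) (PowerSeries.X * PowerSeries.C d) c e c' e' =
      PowerSeries.X ^ (e : ℕ) * PowerSeries.X *
        bondLoc p (-1) 1 1 1 (PowerSeries.C d) c e c' e' := by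
  revert c e c' e'
  simp [Fin.forall_fin_two, bondLoc]
  and_intros <;> ring

theorem X_pow_mul_bondLoc_row (c e c' e' : Fin 2) :
    (PowerSeries.X : ℂ⟦X⟧) ^ (e : ℕ) *
        bondLoc p (-1) 1 (PowerSeries.X ^ 2) 1 (PowerSeries.X * PowerSeries.C d) c e c' e' =
      PowerSeries.X ^ (e' : ℕ) * PowerSeries.X *
        bondLoc p (-1) 1 1 1 (PowerSeries.C d) c e c' e' := by
  revert c e c' e'
  simp [Fin.forall_fin_two, bondLoc]
  and_intros <;> ring

/-- After multiplication by a power of z, a non-zero-divisor, cyclicity carries the first factor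
behind the last one. The closing bond becomes an ordinary bond, and `locK_bulk` applies. -/
theorem prodMat_trace (h : Params p q d) {i j : Fin n} (hi : (i : ℕ) + 1 = n)
    (hj : (j : ℕ) = 0) (hij : i ≠ j) :
    prodMat q n traceLin * bondOp p (bond i j (-1) 1) 1 (PowerSeries.X ^ 2)
        (PowerSeries.X * PowerSeries.C d) =
      bondOp p (bond i j (-1) 1) (PowerSeries.X ^ 2) 1 (PowerSeries.X * PowerSeries.C d) *
        prodMat q n traceLin := by
  refine bondOp_intertwine p hij _ _ _ _ _ _ _ _ _ fun β α => ?_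
  obtain ⟨Y, hY⟩ := prodK_upd_wrap q i j hi hj hij β α
  have hβ := fun c d => hY (β i) (β j) c d
  have hα := fun c d => hY c d (α i) (α j)
  simp only [upd_self] at hβ hα
  have h1 := fun a b => bondLoc_algebraMap (R := ℂ⟦X⟧) p (-1) 1 1 1 d a b
  simp only [map_one, algebraMap_eq_C] at h1
  have key := congrArg (fun M => traceLin (Y * M)) (locK_bulk h (β i) (β j) (α i) (α j))
  simp only [Finset.mul_sum, map_sum, mul_smul_comm, map_smul] at key
  have hX : (PowerSeries.X : ℂ⟦X⟧) ^ ((β j : ℕ) + (α j : ℕ)) ≠ 0 :=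
    pow_ne_zero _ PowerSeries.X_ne_zero
  apply mul_left_cancel₀ hX
  calc _ = PowerSeries.X ^ 2 * ∑ c, ∑ e, bondLoc p (-1) 1 1 1 d c e (α i) (α j) •
        traceLin (Y * (locK q (β i) c * locK q (β j) e)) := by
        simp only [Finset.mul_sum]
        refine Finset.sum_congr rfl fun c _ => Finset.sum_congr rfl fun e _ => ?_
        have h2 := X_pow_mul_bondLoc_col (p := p) (d := d) c e (α i) (α j)
        have h3 := traceLin_locK_mul q (Y * locK q (β i) c) (β j) e
        rw [h1] at h2
        rw [← algebraMap_mul_eq_smul, algebraMap_eq_C, prodMat, Matrix.of_apply, hβ]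
        rw [pow_add] at h3 ⊢
        rw [← mul_assoc, mul_assoc Y] at h3
        rw [mul_mul_mul_comm, h2]
        linear_combination PowerSeries.X * PowerSeries.C (bondLoc p (-1) 1 1 1 d c e (α i) (α j)) *
          h3
    _ = PowerSeries.X ^ 2 * ∑ c, ∑ e, bondLoc p (-1) 1 1 1 d (β i) (β j) c e •
        traceLin (Y * (locK q c (α i) * locK q e (α j))) := by rw [key]
    _ = _ := by
        simp only [Finset.mul_sum]
        refine Finset.sum_congr rfl fun c _ => Finset.sum_congr rfl fun e _ => ?_
        have h2 := X_pow_mul_bondLoc_row (p := p) (d := d) (β i) (β j) c e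
        have h3 := traceLin_locK_mul q (Y * locK q c (α i)) e (α j)
        rw [h1] at h2
        rw [← algebraMap_mul_eq_smul, algebraMap_eq_C, prodMat, Matrix.of_apply, hα]
        rw [pow_add] at h3 ⊢
        rw [← mul_assoc, mul_assoc Y] at h3
        rw [mul_mul_mul_comm, h2]
        linear_combination -PowerSeries.X *
          PowerSeries.C (bondLoc p (-1) 1 1 1 d (β i) (β j) c e) * h3

end

/-! ## The gauge matrix and the spin reversal -/

section
variable {n : ℕ}

/-- Conjugation of intertwining relations by the gauge matrix. -/
theorem gaugeS_intertwine {t μ : ℂ} (hg : Complex.I * sqrtq t μ ≠ 0) (p : ℂ) (v : Fin n → ℤ)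
    {s : ℤ} (hs : ∑ i, v i = s) {u w x u' w' x' : ℂ} {V : Op n}
    (h : V * bondOp p v u w x = bondOp p v u' w' x' * V) :
    gaugeS t μ n * V * (gaugeS t μ n)⁻¹ *
        bondOp p v (u * (Complex.I * sqrtq t μ) ^ (-s)) (w * (Complex.I * sqrtq t μ) ^ s) x =
      bondOp p v (u' * (Complex.I * sqrtq t μ) ^ (-s)) (w' * (Complex.I * sqrtq t μ) ^ s) x' *
        (gaugeS t μ n * V * (gaugeS t μ n)⁻¹) := by
  set g := Complex.I * sqrtq t μ with hgdef
  set S := gaugeS t μ n with hS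
  have hdet : IsUnit S.det := by
    rw [hS, gaugeS, Matrix.det_diagonal, isUnit_iff_ne_zero]
    exact Finset.prod_ne_zero_iff.mpr fun _ _ => pow_ne_zero _ hg
  -- The raising part changes the weight by s and the lowering part by -s, so conjugation by S
  -- rescales them by g^s and g^{-s}.
  have hconj : ∀ u w x : ℂ, S * bondOp p v u w x =
      bondOp p v (u * g ^ (-s)) (w * g ^ s) x * S := by
    intro u w x
    ext β α
    rw [hS, gaugeS, Matrix.diagonal_mul, Matrix.mul_diagonal]
    have e1 : g ^ wt β * shiftOp v β α = g ^ s * shiftOp v β α * g ^ wt α := by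
      by_cases h0 : shiftOp v β α = 0
      · simp [h0]
      · have := wt_eq_of_shiftOp_ne_zero h0
        rw [← zpow_natCast, this, hs, zpow_add₀ hg, zpow_natCast]
        ring
    have e2 : g ^ wt β * shiftOp (-v) β α = g ^ (-s) * shiftOp (-v) β α * g ^ wt α := by
      by_cases h0 : shiftOp (-v) β α = 0
      · simp [h0]
      · have := wt_eq_of_shiftOp_ne_zero h0
        simp only [Pi.neg_apply, Finset.sum_neg_distrib, hs] at this
        rw [← zpow_natCast, this, zpow_add₀ hg, zpow_natCast]
        ring
    have e3 : g ^ wt β * kInvOp p v β α = kInvOp p v β α * g ^ wt α := by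
      by_cases h0 : β = α
      · rw [h0, mul_comm]
      · simp [kInvOp, h0]
    simp only [bondOp, Matrix.of_apply, Algebra.algebraMap_self, RingHom.id_apply]
    linear_combination u * e2 + w * e1 + x * e3
  have hSS : S⁻¹ * S = 1 := Matrix.nonsing_inv_mul _ hdet
  have hSS' : S * S⁻¹ = 1 := Matrix.mul_nonsing_inv _ hdet
  have hconj' : S⁻¹ * bondOp p v (u * g ^ (-s)) (w * g ^ s) x = bondOp p v u w x * S⁻¹ := by
    calc _ = S⁻¹ * (bondOp p v (u * g ^ (-s)) (w * g ^ s) x * S) * S⁻¹ := by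
          rw [mul_assoc, mul_assoc, hSS', mul_one]
      _ = _ := by rw [← hconj, ← mul_assoc, hSS, one_mul]
  calc _ = S * V * (S⁻¹ * bondOp p v (u * g ^ (-s)) (w * g ^ s) x) := by rw [mul_assoc]
    _ = S * (V * bondOp p v u w x) * S⁻¹ := by rw [hconj']; simp only [mul_assoc]
    _ = S * bondOp p v u' w' x' * V * S⁻¹ := by rw [h]; simp only [mul_assoc]
    _ = _ := by rw [hconj]; simp only [mul_assoc]

/-- The reversed configuration. -/
def flip (α : Conf n) : Conf n := fun i => 1 - α i

theorem val_flip (α : Conf n) (i : Fin n) : ((flip α i : ℕ) : ℤ) = 1 - (α i : ℕ) := by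
  simp only [flip]
  generalize α i = a
  fin_cases a <;> rfl

theorem flip_flip (α : Conf n) : flip (flip α) = α := by
  funext i
  simp [flip]

theorem sigmaX_apply (β α : Conf n) : sigmaX n β α = if β = flip α then 1 else 0 := by
  simp only [sigmaX, Matrix.of_apply]
  congr 1
  rw [eq_iff_iff, funext_iff]
  refine forall_congr' fun i => ?_
  simp only [flip]
  generalize α i = a
  generalize β i = b
  fin_cases a <;> fin_cases b <;> simp

theorem mul_sigmaX_apply (A : Op n) (β α : Conf n) : (A * sigmaX n) β α = A β (flip α) := by
  simp [Matrix.mul_apply, sigmaX_apply]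

theorem sigmaX_mul_apply (A : Op n) (β α : Conf n) : (sigmaX n * A) β α = A (flip β) α := by
  have : ∀ γ, β = flip γ ↔ flip β = γ := fun γ =>
    ⟨fun h => by rw [h, flip_flip], fun h => by rw [← h, flip_flip]⟩
  simp [Matrix.mul_apply, sigmaX_apply, this]

theorem sigmaX_mul_self : sigmaX n * sigmaX n = 1 := by
  ext β α
  rw [mul_sigmaX_apply, sigmaX_apply, flip_flip, Matrix.one_apply]

theorem shiftOp_flip (v : Fin n → ℤ) (β α : Conf n) :
    shiftOp v (flip β) (flip α) = shiftOp (-v) β α := by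
  simp only [shiftOp, Matrix.of_apply, val_flip, Pi.neg_apply]
  congr 1
  rw [eq_iff_iff]
  exact forall_congr' fun i => by omega

theorem flip_injective : Function.Injective (flip : Conf n → Conf n) :=
  Function.LeftInverse.injective flip_flip

/-- The exponent of `p` in the eigenvalue of `k` on `|α⟩`. -/
def kExp (v : Fin n → ℤ) (α : Conf n) : ℤ := ∑ i, v i * (2 * ((α i : ℕ) : ℤ) - 1)

/-- Reversal exchanges raising and lowering and inverts k. Exchanging u and w is z ↦ z⁻¹, so only a
diagonal defect remains, to be cancelled between generators. -/
theorem sigmaX_bondOp_sigmaX (p : ℂ) (v : Fin n → ℤ) (u w x : ℂ) :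
    sigmaX n * bondOp p v u w x * sigmaX n = bondOp p v w u x +
      Matrix.diagonal fun α => x * (p ^ kExp v α - p ^ (-kExp v α)) := by
  ext β α
  rw [mul_sigmaX_apply, sigmaX_mul_apply, Matrix.add_apply]
  have hk : kInvOp p v (flip β) (flip α) = Matrix.diagonal (fun α => p ^ kExp v α) β α := by
    have : ∀ α : Conf n, -∑ i, v i * (2 * ((flip α i : ℕ) : ℤ) - 1) = kExp v α := by
      intro α
      rw [kExp, ← Finset.sum_neg_distrib]
      refine Finset.sum_congr rfl fun i _ => ?_
      rw [val_flip]
      ring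
    simp only [kInvOp, Matrix.diagonal_apply, flip_injective.eq_iff, this]
  have hk' : kInvOp p v β α = Matrix.diagonal (fun α => p ^ (-kExp v α)) β α := rfl
  simp only [bondOp, Matrix.of_apply, shiftOp_flip, neg_neg, hk, hk', Algebra.algebraMap_self,
    RingHom.id_apply, Matrix.diagonal_apply]
  split_ifs <;> ring

/-- Spin reversal of a Hamiltonian built from the generators. -/
theorem sigmaX_hamiltonian (p : ℂ) (I : Finset ℕ) (κ d : ℕ → ℂ) (v : ℕ → Fin n → ℤ)
    (x : ℕ → ℂ → ℂ) (hx : ∀ i z, x i z⁻¹ = (x i z)⁻¹) (B : ℕ → ℂ → Op n)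
    (hB : ∀ i ∈ I, ∀ z, B i z = bondOp p (v i) (x i z)⁻¹ (x i z) (d i))
    (hκ : ∀ α : Conf n, ∑ i ∈ I, κ i * (d i * (p ^ kExp (v i) α - p ^ (-kExp (v i) α))) = 0)
    (z : ℂ) :
    sigmaX n * (∑ i ∈ I, κ i • B i z) * sigmaX n = ∑ i ∈ I, κ i • B i z⁻¹ := by
  have h1 : ∀ i ∈ I, sigmaX n * (κ i • B i z) * sigmaX n = κ i • B i z⁻¹ +
      κ i • Matrix.diagonal fun α => d i * (p ^ kExp (v i) α - p ^ (-kExp (v i) α)) := by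
    intro i hi
    rw [hB i hi z, hB i hi z⁻¹, Matrix.mul_smul, Matrix.smul_mul, sigmaX_bondOp_sigmaX, hx,
      inv_inv, smul_add]
  rw [Finset.mul_sum, Finset.sum_mul, Finset.sum_congr rfl h1, Finset.sum_add_distrib]
  convert add_zero _
  ext β α
  rw [Matrix.sum_apply, Matrix.zero_apply]
  by_cases h : β = α
  · subst h
    simpa using hκ β
  · simp [h]

/-- Commutation with a Hamiltonian from the intertwining relations. -/
theorem lie_sigmaX_mul_eq_zero {W H H' : Op n} (hσ : sigmaX n * H * sigmaX n = H')
    (hW : W * H = H' * W) : ⁅sigmaX n * W, H⁆ = 0 := by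
  rw [Ring.lie_def, mul_assoc, hW, ← hσ, sub_eq_zero]
  calc _ = (sigmaX n * sigmaX n) * H * sigmaX n * W := by simp only [mul_assoc]
    _ = _ := by rw [sigmaX_mul_self, one_mul, mul_assoc]

end

/-! ## Parameters -/

section params
variable {t μ ε : ℂ}

theorem qPar_eq (hμ : μ = 1 ∨ μ = -1) : qPar t μ = -t ^ 2 := by
  rw [qPar, sqrtq]
  rcases hμ with rfl | rfl <;> ring_nf <;> simp

theorem qPar_ne_zero (ht0 : t ≠ 0) (hμ : μ = 1 ∨ μ = -1) : qPar t μ ≠ 0 := by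
  rw [qPar_eq hμ]
  exact neg_ne_zero.mpr (pow_ne_zero 2 ht0)

theorem qPar_pow_ne_one (ht : ∀ m : ℕ, 0 < m → t ^ m ≠ 1) (hμ : μ = 1 ∨ μ = -1) (m : ℕ)
    (hm : 0 < m) : qPar t μ ^ m ≠ 1 := by
  rw [qPar_eq hμ]
  intro h
  -- As q = -t², the square of q^m is t^{4m}; squaring removes the sign.
  apply ht (4 * m) (by omega)
  have h1 : t ^ (4 * m) = ((-t ^ 2) ^ m) ^ 2 := by
    rw [pow_right_comm, neg_sq, ← pow_mul, ← pow_mul, ← mul_assoc]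
    norm_num
  rw [h1, h, one_pow]

theorem add_inv_ne_zero {x : ℂ} (h0 : x ≠ 0) (h : x ^ 4 ≠ 1) : x + x⁻¹ ≠ 0 := by
  intro h1
  apply h
  have h2 : x ^ 2 = -1 := by
    field_simp at h1
    linear_combination h1
  linear_combination (x ^ 2 - 1) * h2

theorem gauge_ne_zero (ht0 : t ≠ 0) (hμ : μ = 1 ∨ μ = -1) : Complex.I * sqrtq t μ ≠ 0 := by
  have hμ0 : μ ≠ 0 := by rcases hμ with rfl | rfl <;> simp
  simp [sqrtq, ht0, hμ0]

theorem gauge_sq : (Complex.I * sqrtq t μ) ^ 2 = -qPar t μ := by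
  rw [qPar, mul_pow, Complex.I_sq, neg_one_mul]

theorem gauge_eq : Complex.I * sqrtq t μ = -(μ * t) := by
  rw [sqrtq]
  linear_combination μ * t * Complex.I_mul_I

/-- Both relations come from p² = -q⁻² and d = 1/(q + q⁻¹), whose denominator is nonzero because q⁴
≠ 1. -/
theorem params (ht0 : t ≠ 0) (ht : ∀ m : ℕ, 0 < m → t ^ m ≠ 1) (hμ : μ = 1 ∨ μ = -1)
    (hε : ε = 1 ∨ ε = -1) :
    Params (pPar t μ ε) (qPar t μ) (1 / (qPar t μ + (qPar t μ)⁻¹)) := by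
  have hq := qPar_ne_zero ht0 hμ
  have hs := add_inv_ne_zero hq (qPar_pow_ne_one ht hμ 4 (by norm_num))
  have hp : pPar t μ ε ^ 2 = -(qPar t μ ^ 2)⁻¹ := by
    rw [pPar]
    rcases hε with rfl | rfl <;> simp [mul_pow]
  have hs' : qPar t μ ^ 2 + 1 ≠ 0 := by
    intro h
    apply hs
    field_simp
    rw [h, mul_zero]
  refine ⟨?_, hq, ?_, ?_⟩
  · intro h
    rw [h] at hp
    simp [hq] at hp
  · rw [hp]
    field_simp
    ring
  · rw [hp]
    field_simp
    ring

/-- Since p - p⁻¹ = -iε(q + q⁻¹), the denominator of d¹ cancels and ε² = 1 leaves -i(q^{1/2} +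
q^{-1/2}), which is g⁻¹(1 + q) for g = i q^{1/2}. -/
theorem params₁ (ht0 : t ≠ 0) (ht : ∀ m : ℕ, 0 < m → t ^ m ≠ 1) (hμ : μ = 1 ∨ μ = -1)
    (hε : ε = 1 ∨ ε = -1) :
    Params₁ (pPar t μ ε) (qPar t μ) (dCoeff t μ ε 1) (Complex.I * sqrtq t μ) := by
  have hg := gauge_ne_zero ht0 hμ
  have hq := qPar_ne_zero ht0 hμ
  have hs := add_inv_ne_zero hq (qPar_pow_ne_one ht hμ 4 (by norm_num))
  refine ⟨hg, gauge_sq, ?_⟩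
  have hp : pPar t μ ε - (pPar t μ ε)⁻¹ = -Complex.I * ε * (qPar t μ + (qPar t μ)⁻¹) := by
    rw [pPar]
    rcases hε with rfl | rfl <;> simp <;> ring
  have hs0 : sqrtq t μ ≠ 0 := right_ne_zero_of_mul hg
  have hε2 : ε * ε = 1 := by rcases hε with rfl | rfl <;> simp
  have h1 : (Complex.I * sqrtq t μ)⁻¹ = -Complex.I * (sqrtq t μ)⁻¹ := by
    rw [mul_inv, Complex.inv_I]
  rw [hp, dCoeff, if_pos rfl, h1, div_mul_eq_mul_div, div_eq_iff hs]
  have h2 : (sqrtq t μ)⁻¹ * qPar t μ = sqrtq t μ := by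
    rw [qPar, sq, inv_mul_cancel_left₀ hs0]
  linear_combination -Complex.I * (sqrtq t μ + (sqrtq t μ)⁻¹) *
    (qPar t μ + (qPar t μ)⁻¹) * hε2 + Complex.I * (qPar t μ + (qPar t μ)⁻¹) * h2

end params

/-! ## The generators as bond operators -/

theorem unitVec_eq_single {n j : ℕ} {i : Fin n} (h : (i : ℕ) + 1 = j) :
    unitVec n j = Pi.single i 1 := by
  funext l
  simp only [unitVec, Pi.single_apply, ← h, Nat.add_right_cancel_iff, Fin.val_inj]

theorem neg_unitVec_add_unitVec {n j k : ℕ} {i l : Fin n} (h : (i : ℕ) + 1 = j)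
    (h' : (l : ℕ) + 1 = k) : -unitVec n j + unitVec n k = bond i l (-1) 1 := by
  rw [unitVec_eq_single h, unitVec_eq_single h', bond, Pi.single_neg]

theorem rootA_zero {n : ℕ} {i j : Fin n} (hi : (i : ℕ) + 1 = n) (hj : (j : ℕ) = 0) :
    rootA n 0 = bond i j (-1) 1 := by
  rw [rootA, if_pos rfl]
  exact neg_unitVec_add_unitVec hi (by omega)

theorem rootA_pos {n k : ℕ} {i j : Fin n} (hi : (i : ℕ) + 1 = k) (hj : (j : ℕ) = k) :
    rootA n k = bond i j (-1) 1 := by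
  rw [rootA, if_neg (by omega)]
  exact neg_unitVec_add_unitVec hi (by omega)

theorem rootBD_bulk {n k : ℕ} (r r' : ℕ) {i j : Fin n} (hi : (i : ℕ) + 1 = k) (hj : (j : ℕ) = k) :
    rootBD r r' n k = bond i j (-1) 1 := by
  have := j.isLt
  rw [rootBD, if_neg (by omega), if_neg (by omega)]
  exact neg_unitVec_add_unitVec hi (by omega)

theorem rootBD_zero {n r : ℕ} (hr : r = 1 ∨ r = 2) (r' : ℕ) {i j : Fin n} (hi : (i : ℕ) = 0)
    (hj : (j : ℕ) = 1) : rootBD r r' n 0 = bond i j 1 (if r = 1 then 0 else 1) := by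
  rw [rootBD, if_pos rfl, unitVec_eq_single (i := i) (by omega),
    unitVec_eq_single (i := j) (by omega), bond]
  rcases hr with rfl | rfl <;> simp

theorem rootBD_last {n r' : ℕ} (r : ℕ) (hr' : r' = 1 ∨ r' = 2) {i j : Fin n}
    (hij : (i : ℕ) + 1 = j) (hj : (j : ℕ) + 1 = n) :
    rootBD r r' n n = bond i j (if r' = 1 then 0 else -1) (-1) := by
  rw [rootBD, if_neg (by omega), if_pos rfl, unitVec_eq_single (i := i) (j := n - 1) (by omega),
    unitVec_eq_single (i := j) (j := n) (by omega), bond]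
  rcases hr' with rfl | rfl <;> simp [Pi.single_neg, sub_eq_add_neg, add_comm]

/-- The coefficients of `k⁻¹` in the generators. -/
def dBD (t μ ε : ℂ) (r r' n i : ℕ) : ℂ :=
  if i = 0 then dCoeff t μ ε r else if i = n then dCoeff t μ ε r'
  else 1 / (qPar t μ + (qPar t μ)⁻¹)

section generators
variable {t μ ε : ℂ} (hp : pPar t μ ε ≠ 0)
include hp

theorem bTr_eq {n i : ℕ} (hn : 3 ≤ n) (hi : i < n) (z : ℂ) :
    bTr t μ ε n i z = bondOp (pPar t μ ε) (rootA n i) (if i = 0 then z else 1)⁻¹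
      (if i = 0 then z else 1) (1 / (qPar t μ + (qPar t μ)⁻¹)) := by
  refine onsagerOp_eq hp _ _ ?_
  rcases Nat.eq_zero_or_pos i with rfl | h0
  · rw [rootA_zero (i := ⟨n - 1, by omega⟩) (j := ⟨0, by omega⟩) (by simp; omega) rfl,
      sum_bond_sq (by simp [Fin.ext_iff]; omega)]
    norm_num
  · rw [rootA_pos (i := ⟨i - 1, by omega⟩) (j := ⟨i, hi⟩) (by simp; omega) rfl,
      sum_bond_sq (by simp [Fin.ext_iff]; omega)]
    norm_num

theorem bBD_eq {r r' n i : ℕ} (hr : r = 1 ∨ r = 2) (hr' : r' = 1 ∨ r' = 2) (hn : 2 ≤ n)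
    (hi : i ≤ n) (z : ℂ) :
    bBD t μ ε r r' n i z = bondOp (pPar t μ ε) (rootBD r r' n i) (if i = 0 then z ^ r else 1)⁻¹
      (if i = 0 then z ^ r else 1) (dBD t μ ε r r' n i) := by
  rcases Nat.eq_zero_or_pos i with rfl | h0
  · simp only [bBD, dBD, if_true]
    refine onsagerOp_eq hp _ _ ?_
    rw [rootBD_zero (i := ⟨0, by omega⟩) (j := ⟨1, by omega⟩) hr r' rfl rfl,
      sum_bond_sq (by simp)]
    rcases hr with rfl | rfl <;> norm_num
  · rcases eq_or_lt_of_le hi with rfl | h1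
    · simp only [bBD, dBD, h0.ne', if_true, if_false]
      refine onsagerOp_eq hp _ _ ?_
      rw [rootBD_last (i := ⟨i - 2, by omega⟩) (j := ⟨i - 1, by omega⟩) r hr'
        (by simp; omega) (by simp; omega), sum_bond_sq (by simp [Fin.ext_iff]; omega)]
      rcases hr' with rfl | rfl <;> norm_num
    · simp only [bBD, dBD, h0.ne', h1.ne, if_false]
      refine onsagerOp_eq hp _ _ ?_
      rw [rootBD_bulk (i := ⟨i - 1, by omega⟩) (j := ⟨i, h1⟩) r r' (by simp; omega) rfl,
        sum_bond_sq (by simp [Fin.ext_iff]; omega)]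
      norm_num

end generators

/-! ## Intertwining for each generator -/

/-- Used with c a power of z, to clear the negative powers in b_0 that have no counterpart among
power series. -/
theorem eq_of_smul_bondOp {n : ℕ} {p : ℂ} {v : Fin n → ℤ} {u w x u' w' x' c : ℂ} (hc : c ≠ 0)
    {V : Op n}
    (h : V * bondOp p v (c * u) (c * w) (c * x) = bondOp p v (c * u') (c * w') (c * x') * V) :
    V * bondOp p v u w x = bondOp p v u' w' x' * V := by
  rw [← smul_bondOp, ← smul_bondOp, Matrix.mul_smul, Matrix.smul_mul] at h
  exact smul_right_injective _ hc h

section intertwine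
variable {t μ ε : ℂ} {n : ℕ} {K : Matrix (Conf n) (Conf n) (RatFunc ℂ)} {z : ℂ}

theorem HasVal.C (z c : ℂ) : HasVal z (PowerSeries.C c) c := HasVal.algebraMap z c

theorem HasVal.one (z : ℂ) : HasVal z 1 1 := by
  simpa using HasVal.coe z 1

theorem KTrSeries_eq (q : ℂ) : ∃ f : ℕ → ℂ⟦X⟧,
    (Matrix.of fun β α : Conf n => KTrSeries q β α) =
      prodMat q n traceLin * Matrix.diagonal fun α => f (wt α) := by
  refine ⟨fun l => PowerSeries.C ((-1) ^ l * q ^ min (0 : ℤ) (2 * (l : ℤ) - n)) *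
    (1 - PowerSeries.C (q ^ |(n : ℤ) - 2 * (l : ℤ)|) * PowerSeries.X), ?_⟩
  ext1 β α
  rw [Matrix.mul_diagonal, mul_comm]
  rfl

theorem valueAt_mul_bTr (h : Params (pPar t μ ε) (qPar t μ) (1 / (qPar t μ + (qPar t μ)⁻¹)))
    (hn : 3 ≤ n) (hK : ∀ β α, HasExpansion (K β α) (KTrSeries (qPar t μ) β α))
    (hz0 : z ≠ 0) (hz : IsRegularAt K z) {i : ℕ} (hi : i < n) :
    valueAt K z * bTr t μ ε n i z = bTr t μ ε n i z⁻¹ * valueAt K z := by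
  rw [bTr_eq h.p_ne hn hi, bTr_eq h.p_ne hn hi]
  obtain ⟨f, hf⟩ := KTrSeries_eq (n := n) (qPar t μ)
  -- The prefactor of K_tr depends on α through |α| only, which these generators conserve, so it
  -- passes through them.
  have red : ∀ {v : Fin n → ℤ} {u w x u' w' x' : ℂ⟦X⟧}, ∑ i, v i = 0 →
      prodMat (qPar t μ) n traceLin * bondOp (pPar t μ ε) v u w x =
        bondOp (pPar t μ ε) v u' w' x' * prodMat (qPar t μ) n traceLin →
      (Matrix.of fun β α : Conf n => KTrSeries (qPar t μ) β α) * bondOp (pPar t μ ε) v u w x =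
        bondOp (pPar t μ ε) v u' w' x' * Matrix.of fun β α : Conf n => KTrSeries (qPar t μ) β α := by
    intro v u w x u' w' x' hv hG
    rw [hf, mul_assoc, diagonal_wt_mul_bondOp _ hv, ← mul_assoc, hG, mul_assoc]
  rcases Nat.eq_zero_or_pos i with rfl | h0
  · simp only [if_true]
    rw [rootA_zero (i := ⟨n - 1, by omega⟩) (j := ⟨0, by omega⟩) (by simp; omega) rfl]
    refine eq_of_smul_bondOp hz0 ?_
    rw [mul_inv_cancel₀ hz0, inv_inv, ← sq]
    refine valueAt_mul_eq hK hz (HasVal.bondOp (HasVal.one z) ((HasVal.X z).pow 2)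
        ((HasVal.X z).mul (HasVal.C z _)))
      (HasVal.bondOp ((HasVal.X z).pow 2) (HasVal.one z) ((HasVal.X z).mul (HasVal.C z _)))
      (red (by simp [sum_bond]) (prodMat_trace h (by simp; omega) rfl
        (by simp [Fin.ext_iff]; omega)))
  · simp only [h0.ne', if_false, inv_one]
    rw [rootA_pos (i := ⟨i - 1, by omega⟩) (j := ⟨i, hi⟩) (by simp; omega) rfl]
    exact valueAt_mul_eq hK hz (HasVal.bondOp (HasVal.one z) (HasVal.one z) (HasVal.C z _))
      (HasVal.bondOp (HasVal.one z) (HasVal.one z) (HasVal.C z _))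
      (red (by simp [sum_bond]) (prodMat_bulk h _ (by simp; omega)))

theorem KSeries_eq (q : ℂ) (k k' : ℕ) : ∃ c : ℂ⟦X⟧,
    (Matrix.of fun β α : Conf n => KSeries q k k' β α) = c • prodMat q n (bdryLin q k k') :=
  ⟨if k = 2 ∧ k' = 2 ∧ Odd n then bdry q k k' 1 else (bdry q k k' 1)⁻¹, rfl⟩

theorem gauge_mul_bBD (ht0 : t ≠ 0) (ht : ∀ m : ℕ, 0 < m → t ^ m ≠ 1) (hμ : μ = 1 ∨ μ = -1)
    (hε : ε = 1 ∨ ε = -1) {r r' : ℕ} (hr : r = 1 ∨ r = 2) (hr' : r' = 1 ∨ r' = 2)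
    (hn : 2 ≤ n) (hK : ∀ β α, HasExpansion (K β α) (KSeries (qPar t μ) r r' β α))
    (hz0 : z ≠ 0) (hz : IsRegularAt K z) {i : ℕ} (hi : i ≤ n) :
    gaugeS t μ n * valueAt K z * (gaugeS t μ n)⁻¹ * bBD t μ ε r r' n i z =
      bBD t μ ε r r' n i z⁻¹ * (gaugeS t μ n * valueAt K z * (gaugeS t μ n)⁻¹) := by
  have h := params ht0 ht hμ hε
  have h₁ := params₁ ht0 ht hμ hε
  have hq := qPar_pow_ne_one (t := t) ht hμ
  have hq0 := h.q_ne
  have hg := gauge_ne_zero (t := t) ht0 hμ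
  have hgq : (Complex.I * sqrtq t μ) ^ 2 = -qPar t μ := gauge_sq
  rw [bBD_eq h.p_ne hr hr' hn hi, bBD_eq h.p_ne hr hr' hn hi]
  obtain ⟨c, hc⟩ := KSeries_eq (n := n) (qPar t μ) r r'
  have red : ∀ {v : Fin n → ℤ} {u w x u' w' x' : ℂ⟦X⟧},
      prodMat (qPar t μ) n (bdryLin (qPar t μ) r r') * bondOp (pPar t μ ε) v u w x =
        bondOp (pPar t μ ε) v u' w' x' * prodMat (qPar t μ) n (bdryLin (qPar t μ) r r') →
      (Matrix.of fun β α : Conf n => KSeries (qPar t μ) r r' β α) *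
          bondOp (pPar t μ ε) v u w x =
        bondOp (pPar t μ ε) v u' w' x' *
          Matrix.of fun β α : Conf n => KSeries (qPar t μ) r r' β α := by
    intro v u w x u' w' x' hG
    rw [hc, Matrix.smul_mul, hG, Matrix.mul_smul]
  rcases Nat.eq_zero_or_pos i with rfl | h0
  · simp only [if_true, dBD]
    rw [rootBD_zero (i := ⟨0, by omega⟩) (j := ⟨1, by omega⟩) hr r' rfl rfl]
    rcases hr with rfl | rfl
    · have key := valueAt_mul_eq hK hz
        (HasVal.bondOp (HasVal.C z _) (((HasVal.X z).pow 2).mul (HasVal.C z _))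
          ((HasVal.X z).mul (HasVal.C z _)))
        (HasVal.bondOp (((HasVal.X z).pow 2).mul (HasVal.C z _)) (HasVal.C z _)
          ((HasVal.X z).mul (HasVal.C z _)))
        (red (prodMat_left (i := ⟨0, by omega⟩) (j := ⟨1, by omega⟩) rfl rfl
          (locK_left_one h₁ _ (bdryLin_one_aPlus hq r') (bdryLin_one_aMinus hq r'))))
      have key' := gaugeS_intertwine (n := n) hg (pPar t μ ε)
        (bond ⟨0, by omega⟩ ⟨1, by omega⟩ 1 0) (s := 1) (by simp [sum_bond]) key
      refine eq_of_smul_bondOp hz0 ?_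
      generalize Complex.I * sqrtq t μ = g at *
      convert key' using 2
      · congr 1 <;> simp <;> field_simp
      · congr 1 <;> simp <;> field_simp
    · have key := valueAt_mul_eq hK hz
        (HasVal.bondOp (HasVal.C z _) (((HasVal.X z).pow 4).mul (HasVal.C z _))
          (((HasVal.X z).pow 2).mul (HasVal.C z _)))
        (HasVal.bondOp (((HasVal.X z).pow 4).mul (HasVal.C z _)) (HasVal.C z _)
          (((HasVal.X z).pow 2).mul (HasVal.C z _)))
        (red (prodMat_left (i := ⟨0, by omega⟩) (j := ⟨1, by omega⟩) rfl rfl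
          (locK_left_two h _ (bdryLin_two_aPlus hq r'))))
      have key' := gaugeS_intertwine (n := n) hg (pPar t μ ε)
        (bond ⟨0, by omega⟩ ⟨1, by omega⟩ 1 1) (s := 2) (by simp [sum_bond]) key
      refine eq_of_smul_bondOp (pow_ne_zero 2 hz0) ?_
      rw [zpow_neg, zpow_ofNat, hgq] at key'
      convert key' using 2
      · congr 1 <;> simp <;> field_simp
      · congr 1 <;> simp <;> field_simp
  · rcases eq_or_lt_of_le hi with rfl | h1
    · simp only [h0.ne', if_true, if_false, dBD, inv_one]
      rw [rootBD_last (i := ⟨i - 2, by omega⟩) (j := ⟨i - 1, by omega⟩) r hr'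
        (by simp; omega) (by simp; omega)]
      rcases hr' with rfl | rfl
      · have key := valueAt_mul_eq hK hz
          (HasVal.bondOp (HasVal.C z _) (HasVal.C z _) (HasVal.C z _))
          (HasVal.bondOp (HasVal.C z _) (HasVal.C z _) (HasVal.C z _))
          (red (prodMat_right (i := ⟨i - 2, by omega⟩) (j := ⟨i - 1, by omega⟩)
            (by simp; omega) (by simp; omega)
            (locK_right_one h₁ (aPlus_eta_one hq) (aMinus_eta_one hq))))
        have key' := gaugeS_intertwine hg (pPar t μ ε)
          (bond ⟨i - 2, by omega⟩ ⟨i - 1, by omega⟩ 0 (-1)) (s := -1) (by simp [sum_bond]) key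
        rw [neg_neg, zpow_neg, zpow_one, inv_mul_cancel₀ hg, mul_inv_cancel₀ hg] at key'
        simpa using key'
      · have key := valueAt_mul_eq hK hz
          (HasVal.bondOp (HasVal.C z _) (HasVal.C z _) (HasVal.C z _))
          (HasVal.bondOp (HasVal.C z _) (HasVal.C z _) (HasVal.C z _))
          (red (prodMat_right (i := ⟨i - 2, by omega⟩) (j := ⟨i - 1, by omega⟩)
            (by simp; omega) (by simp; omega) (locK_right_two h (aMinus_eta_two hq))))
        have key' := gaugeS_intertwine hg (pPar t μ ε)
          (bond ⟨i - 2, by omega⟩ ⟨i - 1, by omega⟩ (-1) (-1)) (s := -2) (by simp [sum_bond]) key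
        rw [neg_neg, zpow_neg, zpow_ofNat, hgq] at key'
        simpa [hq0, dCoeff] using key'
    · simp only [h0.ne', h1.ne, if_false, dBD, inv_one]
      rw [rootBD_bulk (i := ⟨i - 1, by omega⟩) (j := ⟨i, h1⟩) r r' (by simp; omega) rfl]
      have key := valueAt_mul_eq hK hz
        (HasVal.bondOp (HasVal.one z) (HasVal.one z) (HasVal.C z _))
        (HasVal.bondOp (HasVal.one z) (HasVal.one z) (HasVal.C z _))
        (red (prodMat_bulk h _ (i := ⟨i - 1, by omega⟩) (j := ⟨i, h1⟩) (by simp; omega)))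
      have key' := gaugeS_intertwine hg (pPar t μ ε)
        (bond ⟨i - 1, by omega⟩ ⟨i, h1⟩ (-1) 1) (s := 0) (by simp [sum_bond]) key
      simpa using key'

end intertwine

/-! ## The spin reversal of the Hamiltonians -/

/-- The occupation number of site `j`, for a natural number `j`. -/
def occ {n : ℕ} (α : Conf n) (j : ℕ) : ℂ := if h : j < n then ((α ⟨j, h⟩ : ℕ) : ℂ) else 0

theorem occ_val {n : ℕ} (α : Conf n) (i : Fin n) : occ α i = ((α i : ℕ) : ℂ) := by
  simp [occ]

theorem kExp_bond {n : ℕ} (i j : Fin n) (a b : ℤ) (α : Conf n) :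
    kExp (bond i j a b) α = a * (2 * ((α i : ℕ) : ℤ) - 1) + b * (2 * ((α j : ℕ) : ℤ) - 1) :=
  sum_bond_mul i j a b _

section
variable {p q d : ℂ} {n : ℕ}

/-- The exponent is 0 or ±2, and d(p² - p⁻²) = q - q⁻¹. On these values the defect is therefore
linear in the occupations, which lets it telescope. -/
theorem kExp_diff_bulk (h : Params p q d) (i j : Fin n) (α : Conf n) :
    d * (p ^ kExp (bond i j (-1) 1) α - p ^ (-kExp (bond i j (-1) 1) α)) =
      (q - q⁻¹) * (occ α j - occ α i) := by
  rw [kExp_bond, occ_val, occ_val]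
  generalize α i = a
  generalize α j = b
  have h1 := h.mul_sq
  have h2 := h.mul_sq_inv
  fin_cases a <;> fin_cases b <;> simp [zpow_ofNat]
  · linear_combination h1 - h2
  · linear_combination h2 - h1

theorem kExp_diff_two (h : Params p q d) (i j : Fin n) {s : ℤ} (hs : s = 1 ∨ s = -1)
    (α : Conf n) :
    d * (p ^ kExp (bond i j s s) α - p ^ (-kExp (bond i j s s) α)) =
      s * ((q - q⁻¹) * (occ α i + occ α j - 1)) := by
  rw [kExp_bond, occ_val, occ_val]
  generalize α i = a
  generalize α j = b
  have h1 := h.mul_sq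
  have h2 := h.mul_sq_inv
  rcases hs with rfl | rfl <;> fin_cases a <;> fin_cases b <;> simp [zpow_ofNat]
  · linear_combination h2 - h1
  · linear_combination h1 - h2
  · linear_combination h1 - h2
  · linear_combination h2 - h1

theorem kExp_diff_left {g : ℂ} (h : Params₁ p q d g) (i j : Fin n) (α : Conf n) :
    d * (p ^ kExp (bond i j 1 0) α - p ^ (-kExp (bond i j 1 0) α)) =
      g⁻¹ * (1 + q) * (2 * occ α i - 1) := by
  rw [kExp_bond, occ_val, ← h.mul_sub]
  generalize α i = a
  fin_cases a <;> simp <;> ring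

theorem kExp_diff_right {g : ℂ} (h : Params₁ p q d g) (i j : Fin n) (α : Conf n) :
    d * (p ^ kExp (bond i j 0 (-1)) α - p ^ (-kExp (bond i j 0 (-1)) α)) =
      -(g⁻¹ * (1 + q) * (2 * occ α j - 1)) := by
  rw [kExp_bond, occ_val, ← h.mul_sub]
  generalize α j = a
  fin_cases a <;> simp
  ring

end

section
variable {t μ ε : ℂ} (ht0 : t ≠ 0) (ht : ∀ m : ℕ, 0 < m → t ^ m ≠ 1) (hμ : μ = 1 ∨ μ = -1)
  (hε : ε = 1 ∨ ε = -1)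
include ht0 ht hμ hε

theorem sigmaX_HTr {n : ℕ} (hn : 3 ≤ n) (z : ℂ) :
    sigmaX n * HTr t μ ε n z * sigmaX n = HTr t μ ε n z⁻¹ := by
  have h := params ht0 ht hμ hε
  have key := sigmaX_hamiltonian (n := n) (pPar t μ ε) (Finset.range n) (fun _ => 1)
    (fun _ => 1 / (qPar t μ + (qPar t μ)⁻¹)) (rootA n) (fun i z => if i = 0 then z else 1)
    (fun i z => by split_ifs <;> simp) (bTr t μ ε n)
    (fun i hi z => bTr_eq h.p_ne hn (Finset.mem_range.mp hi) z) ?_ z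
  · simpa [HTr] using key
  · intro α
    simp only [one_mul]
    obtain ⟨m, rfl⟩ : ∃ m, n = m + 1 := ⟨n - 1, by omega⟩
    rw [Finset.sum_range_succ', rootA_zero (i := Fin.last m) (j := 0) (by simp) (by simp),
      kExp_diff_bulk h]
    have h1 : ∀ i ∈ Finset.range m, 1 / (qPar t μ + (qPar t μ)⁻¹) *
        (pPar t μ ε ^ kExp (rootA (m + 1) (i + 1)) α -
          pPar t μ ε ^ (-kExp (rootA (m + 1) (i + 1)) α)) =
        (qPar t μ - (qPar t μ)⁻¹) * occ α (i + 1) - (qPar t μ - (qPar t μ)⁻¹) * occ α i := by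
      intro i hi
      rw [Finset.mem_range] at hi
      rw [rootA_pos (i := ⟨i, by omega⟩) (j := ⟨i + 1, by omega⟩) rfl rfl, kExp_diff_bulk h,
        mul_sub]
    rw [Finset.sum_congr rfl h1,
      Finset.sum_range_sub fun i => (qPar t μ - (qPar t μ)⁻¹) * occ α i]
    simp only [Fin.val_last, Fin.val_zero]
    ring

omit hε in
theorem kappaBD_ne_zero {r r' : ℕ} (hr : r = 1 ∨ r = 2) (hr' : r' = 1 ∨ r' = 2) (n i : ℕ) :
    kappaBD t μ r r' n i ≠ 0 := by
  have hμ0 : μ ≠ 0 := by rcases hμ with rfl | rfl <;> simp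
  have h1 : μ * (t + t⁻¹) ≠ 0 := mul_ne_zero hμ0 (add_inv_ne_zero ht0 (ht 4 (by norm_num)))
  have h2 : -(μ * (t + t⁻¹) / 2) ≠ 0 := neg_ne_zero.mpr (div_ne_zero h1 two_ne_zero)
  have h3 : -(μ * (t + t⁻¹)) ≠ 0 := neg_ne_zero.mpr h1
  rcases hr with rfl | rfl <;> rcases hr' with rfl | rfl <;> simp only [kappaBD] <;>
    split_ifs <;> first | assumption | norm_num

/-- With equal weights the bulk defects telescope to the two ends. A two-site end generator and the
adjacent bond, both of weight 1, together give ±Q(2α - 1) with α the inner of the two end spins,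
which fits bulk weight 2. A one-site end generator gives a multiple of 2α - 1 in the end spin, and
its κ scales this to half the bulk weight times ±Q. -/
theorem sum_kappaBD {r r' n : ℕ} (hr : r = 1 ∨ r = 2) (hr' : r' = 1 ∨ r' = 2) (hn : 2 ≤ n)
    (hn' : ¬(r = 1 ∧ r' = 1) → 3 ≤ n) (α : Conf n) :
    ∑ i ∈ Finset.range (n + 1), kappaBD t μ r r' n i * (dBD t μ ε r r' n i *
      (pPar t μ ε ^ kExp (rootBD r r' n i) α - pPar t μ ε ^ (-kExp (rootBD r r' n i) α))) = 0 := by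
  have h := params ht0 ht hμ hε
  have h₁ := params₁ ht0 ht hμ hε
  set Q := qPar t μ - (qPar t μ)⁻¹ with hQ
  -- The origin of μ(t + t⁻¹) in H: with i q^{1/2} = -μt and q = -t² it converts the defect of a
  -- one-site generator into the bulk unit Q.
  have hκ : μ * (t + t⁻¹) * ((Complex.I * sqrtq t μ)⁻¹ * (1 + qPar t μ)) = -Q := by
    rw [hQ, gauge_eq, qPar_eq hμ]
    rcases hμ with rfl | rfl <;> field_simp <;> ring
  obtain ⟨m, rfl⟩ : ∃ m, n = m + 2 := ⟨n - 2, by omega⟩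
  have hbulk : ∀ i ∈ Finset.range (m + 1), kappaBD t μ r r' (m + 2) (i + 1) *
      (dBD t μ ε r r' (m + 2) (i + 1) * (pPar t μ ε ^ kExp (rootBD r r' (m + 2) (i + 1)) α -
        pPar t μ ε ^ (-kExp (rootBD r r' (m + 2) (i + 1)) α))) =
      kappaBD t μ r r' (m + 2) (i + 1) * (Q * (occ α (i + 1) - occ α i)) := by
    intro i hi
    rw [Finset.mem_range] at hi
    rw [rootBD_bulk r r' (i := ⟨i, by omega⟩) (j := ⟨i + 1, by omega⟩) rfl rfl, dBD,
      if_neg (by omega), if_neg (by omega), kExp_diff_bulk h]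
  have hsum : ∀ (c : ℂ) (k : ℕ), ∑ i ∈ Finset.range k, c * (Q * (occ α (i + 1) - occ α i)) =
      c * (Q * (occ α k - occ α 0)) := by
    intro c k
    rw [← Finset.mul_sum, ← Finset.mul_sum, Finset.sum_range_sub]
  rw [Finset.sum_range_succ, Finset.sum_range_succ', Finset.sum_congr rfl hbulk,
    rootBD_zero (i := 0) (j := 1) hr r' (by simp) (by simp),
    rootBD_last (i := (Fin.last m).castSucc) (j := Fin.last (m + 1)) r hr' (by simp) (by simp)]
  simp only [dBD, if_true, if_neg (Nat.succ_ne_zero (m + 1))]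
  have hl1 := kExp_diff_left h₁ (0 : Fin (m + 2)) 1 α
  have hr1 := kExp_diff_right h₁ (Fin.last m).castSucc (Fin.last (m + 1)) α
  have hl2 := kExp_diff_two h (0 : Fin (m + 2)) 1 (Or.inl rfl) α
  have hr2 := kExp_diff_two h (Fin.last m).castSucc (Fin.last (m + 1)) (Or.inr rfl) α
  simp only [Fin.val_zero, Fin.val_one, Fin.val_castSucc, Fin.val_last] at hl1 hr1 hl2 hr2
  generalize (Complex.I * sqrtq t μ)⁻¹ * (1 + qPar t μ) = G at hκ hl1 hr1
  have hd2 : dCoeff t μ ε 2 = 1 / (qPar t μ + (qPar t μ)⁻¹) := by simp [dCoeff]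
  rcases hr with rfl | rfl <;> rcases hr' with rfl | rfl
  · rw [if_pos rfl, if_pos rfl, hl1, hr1]
    have hk : ∀ i ∈ Finset.range (m + 1), kappaBD t μ 1 1 (m + 2) (i + 1) *
        (Q * (occ α (i + 1) - occ α i)) = 1 * (Q * (occ α (i + 1) - occ α i)) := by
      intro i hi
      rw [Finset.mem_range] at hi
      rw [kappaBD, if_neg (by omega)]
    rw [Finset.sum_congr rfl hk, hsum]
    simp only [kappaBD, true_or, or_true, if_true]
    linear_combination (occ α (m + 1) - occ α 0) * hκ
  · obtain ⟨k, rfl⟩ : ∃ k, m = k + 1 := ⟨m - 1, by have := hn' (by simp); omega⟩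
    rw [if_pos rfl, if_neg (by norm_num), hl1, hd2, hr2]
    have hk : ∀ i ∈ Finset.range (k + 1), kappaBD t μ 1 2 (k + 1 + 2) (i + 1) *
        (Q * (occ α (i + 1) - occ α i)) = 2 * (Q * (occ α (i + 1) - occ α i)) := by
      intro i hi
      rw [Finset.mem_range] at hi
      rw [kappaBD, if_neg (by omega), if_neg (by omega)]
    rw [Finset.sum_range_succ, Finset.sum_congr rfl hk, hsum]
    simp [kappaBD]
    linear_combination -(2 * occ α 0 - 1) * hκ
  · obtain ⟨k, rfl⟩ : ∃ k, m = k + 1 := ⟨m - 1, by have := hn' (by simp); omega⟩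
    rw [if_neg (by norm_num), if_pos rfl, hr1, hd2, hl2]
    have hk : ∀ i ∈ Finset.range (k + 1), kappaBD t μ 2 1 (k + 1 + 2) (i + 1 + 1) *
        (Q * (occ α (i + 1 + 1) - occ α (i + 1))) =
        2 * (Q * (occ α (i + 1 + 1) - occ α (i + 1))) := by
      intro i hi
      rw [Finset.mem_range] at hi
      rw [kappaBD, if_neg (by omega), if_neg (by omega)]
    have hs := hsum 2 (k + 2)
    rw [Finset.sum_range_succ'] at hs
    rw [Finset.sum_range_succ', Finset.sum_congr rfl hk]
    simp [kappaBD]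
    simp only [zero_add] at hs
    linear_combination hs + (2 * occ α (k + 2) - 1) * hκ
  · obtain ⟨k, rfl⟩ : ∃ k, m = k + 1 := ⟨m - 1, by have := hn' (by simp); omega⟩
    rw [if_neg (by norm_num), if_neg (by norm_num), hd2, hl2, hr2]
    have hk : ∀ i ∈ Finset.range k, kappaBD t μ 2 2 (k + 1 + 2) (i + 1 + 1) *
        (Q * (occ α (i + 1 + 1) - occ α (i + 1))) =
        2 * (Q * (occ α (i + 1 + 1) - occ α (i + 1))) := by
      intro i hi
      rw [Finset.mem_range] at hi
      rw [kappaBD, if_neg (by omega)]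
    have hs := hsum 2 (k + 1)
    rw [Finset.sum_range_succ'] at hs
    rw [Finset.sum_range_succ, Finset.sum_range_succ', Finset.sum_congr rfl hk]
    simp [kappaBD]
    simp only [zero_add] at hs
    linear_combination hs

theorem sigmaX_HBD {r r' n : ℕ} (hr : r = 1 ∨ r = 2) (hr' : r' = 1 ∨ r' = 2) (hn : 2 ≤ n)
    (hn' : ¬(r = 1 ∧ r' = 1) → 3 ≤ n) (z : ℂ) :
    sigmaX n * HBD t μ ε r r' n z * sigmaX n = HBD t μ ε r r' n z⁻¹ :=
  sigmaX_hamiltonian (n := n) (pPar t μ ε) (Finset.range (n + 1)) (kappaBD t μ r r' n)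
    (dBD t μ ε r r' n) (rootBD r r' n) (fun i z => if i = 0 then z ^ r else 1)
    (fun i z => by split_ifs <;> simp) (bBD t μ ε r r' n)
    (fun i hi z => bBD_eq (params ht0 ht hμ hε).p_ne hr hr' hn
      (by have := Finset.mem_range.mp hi; omega) z)
    (sum_kappaBD ht0 ht hμ hε hr hr' hn hn') z

end

end

end OnsagerSpin

/-! ### The theorem. -/

open OnsagerSpin in
theorem mainTheorem3 (t μ ε : ℂ) (ht0 : t ≠ 0) (ht : ∀ m : ℕ, 0 < m → t ^ m ≠ 1)
    (hμ : μ = 1 ∨ μ = -1) (hε : ε = 1 ∨ ε = -1) :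
    (∀ n : ℕ, 3 ≤ n →
      (∀ z : ℂ, z ≠ 0 → sigmaX n * HTr t μ ε n z * sigmaX n = HTr t μ ε n z⁻¹) ∧
      ∃ K : Matrix (Conf n) (Conf n) (RatFunc ℂ),
        (∀ β α, HasExpansion (K β α) (KTrSeries (qPar t μ) β α)) ∧
        ∀ z : ℂ, z ≠ 0 → IsRegularAt K z → ⁅KveeTr K z, HTr t μ ε n z⁆ = 0) ∧
    (∀ r r' n : ℕ, (r = 1 ∨ r = 2) → (r' = 1 ∨ r' = 2) →
      2 ≤ n → (¬ (r = 1 ∧ r' = 1) → 3 ≤ n) →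
      (∀ i ≤ n, kappaBD t μ r r' n i ≠ 0) ∧
      (∀ z : ℂ, z ≠ 0 → sigmaX n * HBD t μ ε r r' n z * sigmaX n = HBD t μ ε r r' n z⁻¹) ∧
      ∃ K : Matrix (Conf n) (Conf n) (RatFunc ℂ),
        (∀ β α, HasExpansion (K β α) (KSeries (qPar t μ) r r' β α)) ∧
        ∀ z : ℂ, z ≠ 0 → IsRegularAt K z → ⁅KveeBD t μ K z, HBD t μ ε r r' n z⁆ = 0) := by
  have hq0 := qPar_ne_zero ht0 hμ
  have hq := qPar_pow_ne_one ht hμ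
  refine ⟨fun n hn => ⟨fun z _ => sigmaX_HTr ht0 ht hμ hε hn z, ?_⟩,
    fun r r' n hr hr' hn hn' => ⟨fun i _ => kappaBD_ne_zero ht0 ht hμ hr hr' n i,
      fun z _ => sigmaX_HBD ht0 ht hμ hε hr hr' hn hn' z, ?_⟩⟩
  · choose K hK using fun β α : Conf n => exists_hasExpansion (ratMul_KTrSeries hq0 β α)
    refine ⟨K, hK, fun z hz0 hz => ?_⟩
    refine lie_sigmaX_mul_eq_zero (sigmaX_HTr ht0 ht hμ hε hn z) ?_
    rw [HTr, HTr, Finset.mul_sum, Finset.sum_mul]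
    exact Finset.sum_congr rfl fun i hi =>
      valueAt_mul_bTr (params ht0 ht hμ hε) hn hK hz0 hz (Finset.mem_range.mp hi)
  · choose K hK using fun β α : Conf n =>
      exists_hasExpansion (ratMul_KSeries hq0 hq hr hr' β α)
    refine ⟨K, hK, fun z hz0 hz => ?_⟩
    refine lie_sigmaX_mul_eq_zero (sigmaX_HBD ht0 ht hμ hε hr hr' hn hn' z) ?_
    rw [HBD, HBD, Finset.mul_sum, Finset.sum_mul]
    refine Finset.sum_congr rfl fun i hi => ?_
    rw [Matrix.mul_smul, Matrix.smul_mul,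
      gauge_mul_bBD ht0 ht hμ hε hr hr' hn hK hz0 hz (by have := Finset.mem_range.mp hi; omega)]
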